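/- A finite set $\mathcal A\subset\mathbb R^d$ is in *general position* if every $d+1$ of its points are affinely independent, i.e. no $d+1$ of them lie in an affine hyperplane. A *triangulation* of $\mathcal A$ is a collection $T$ of affinely independent subsets $\sigma\subseteq\mathcal A$ (*cells*), each with the same affine span as $\mathcal A$, such that $\operatorname{conv}(\sigma)\cap\operatorname{conv}(\sigma')$ is a (possibly empty) face of both $\operatorname{conv}(\sigma)$ and $\operatorname{conv}(\sigma')$ for all $\sigma,\sigma'\in T$, and $\bigcup_{\sigma\in T}\operatorname{conv}(\sigma)=\operatorname{conv}(\mathcal A)$. (Points of $\mathcal A$ may be unused by $T$.) The *link* of $\tau\subseteq\mathcal A$ in $T$ is $\operatorname{link}_T(\tau)=\{\rho\subseteq\mathcal A:\rho\cap\tau=\emptyset,\ \rho\cup\tau\in T\}$. A *circuit* of $\mathcal A$ is a minimal affinely dependent subset $C\subseteq \mathcal A$; its affine dependence $\sum_{c\in C}\lambda_c c=0$, $\sum_{c\in C}\lambda_c=0$ (unique up to a nonzero factor, with all $\lambda_c\neq0$) splits it as $C=C_+\cup C_-$ according to the sign of $\lambda_c$; the roles of $C_+$ and $C_-$ may be interchanged.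 Put $T^C_{\pm}=\{C\setminus\{c\}:c\in C_\pm\}$. A triangulation $T_2$ of $\mathcal A$ is obtained from a triangulation $T_1$ of $\mathcal A$ by a *geometric bistellar flip* if, for some circuit $C=(C_+,C_-)$, all $\tau\in T^C_+$ have the same nonempty link $L$ in $T_1$ and $$T_2=\bigl(T_1\setminus\{\rho\cup\tau:\rho\in L,\ \tau\in T^C_+\}\bigr)\cup\{\rho\cup\tau:\rho\in L,\ \tau\in T^C_-\}.$$ The *graph of triangulations* of $\mathcal A$ has all triangulations of $\mathcal A$ as its vertices and the geometric bistellar flips between them as its edges. **Theorem.** There is a set of $17$ points in general position in $\mathbb R^6$ whose graph of triangulations is not connected; that is, it has two triangulations that cannot be joined by a finite sequence of geometric bistellar flips. -/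

import Mathlib

/-!
Triangulations of a finite labelled point configuration `p : ι → ℝ^d`, and geometric bistellar
flips between them. Subsets of the configuration are represented by finsets of labels.
-/

namespace PointConfiguration

variable {d : ℕ} {ι : Type*}

/-- The points labelled by `σ`. -/
def points (p : ι → EuclideanSpace ℝ (Fin d)) (σ : Finset ι) : Set (EuclideanSpace ℝ (Fin d)) :=
  p '' (σ : Set ι)

/-- The points labelled by `σ` are affinely independent. -/
def Independent (p : ι → EuclideanSpace ℝ (Fin d)) (σ : Finset ι) : Prop :=
  AffineIndependent ℝ (fun i : σ => p i)

/-- A configuration in `ℝ^d` is in general position if any `d + 1` of its points are affinely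
independent, i.e. no `d + 1` of them lie in a common affine hyperplane. -/
def GeneralPosition (p : ι → EuclideanSpace ℝ (Fin d)) : Prop :=
  ∀ σ : Finset ι, σ.card = d + 1 → Independent p σ

/-- A triangulation: a collection of affinely spanning and affinely independent subsets, whose
convex hulls intersect pairwise in a common face and cover the convex hull of the configuration.
(`IsExposed ℝ P F` says that `F` is empty, or is the subset of `P` on which some linear
functional attains its maximum over `P`; for polytopes `P` these are exactly the faces, with
`∅` and `P` included.) -/
structure IsTriangulation (p : ι → EuclideanSpace ℝ (Fin d)) (T : Finset (Finset ι)) : Prop where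
  independent : ∀ σ ∈ T, Independent p σ
  spanning : ∀ σ ∈ T, affineSpan ℝ (points p σ) = affineSpan ℝ (Set.range p)
  face : ∀ σ ∈ T, ∀ σ' ∈ T,
    IsExposed ℝ (convexHull ℝ (points p σ))
      (convexHull ℝ (points p σ) ∩ convexHull ℝ (points p σ')) ∧
    IsExposed ℝ (convexHull ℝ (points p σ'))
      (convexHull ℝ (points p σ) ∩ convexHull ℝ (points p σ'))
  cover : ⋃ σ ∈ T, convexHull ℝ (points p σ) = convexHull ℝ (Set.range p)

/-- A circuit: a minimal affinely dependent subset. -/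
def IsCircuit (p : ι → EuclideanSpace ℝ (Fin d)) (C : Finset ι) : Prop :=
  ¬ Independent p C ∧ ∀ D : Finset ι, D ⊂ C → Independent p D

variable [DecidableEq ι]

/-- `(P, N)` is a signed circuit: `P ∪ N` is a circuit, and it has an affine dependence which is
positive exactly on `P` and negative exactly on `N`. -/
def IsSignedCircuit (p : ι → EuclideanSpace ℝ (Fin d)) (P N : Finset ι) : Prop :=
  IsCircuit p (P ∪ N) ∧
    ∃ w : ι → ℝ, (∀ i ∈ P, 0 < w i) ∧ (∀ i ∈ N, w i < 0) ∧
      ∑ i ∈ P ∪ N, w i = 0 ∧ ∑ i ∈ P ∪ N, w i • p i = 0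

/-- The collection `{C \ {c} : c ∈ P}`. For a signed circuit `(P, N)` with `C = P ∪ N`, the two
triangulations of `C` are `deletions C P` and `deletions C N`. -/
def deletions (C P : Finset ι) : Finset (Finset ι) :=
  P.image fun c => C.erase c

variable [Fintype ι]

/-- The link of `τ` in `T`: all `ρ` disjoint from `τ` with `ρ ∪ τ ∈ T`. -/
def link (T : Finset (Finset ι)) (τ : Finset ι) : Finset (Finset ι) :=
  Finset.univ.filter fun ρ => Disjoint ρ τ ∧ ρ ∪ τ ∈ T

/-- `T₂` is obtained from `T₁` by a geometric bistellar flip: for some signed circuit `(P, N)` with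
support `C = P ∪ N`, all members of the triangulation `deletions C P` of `C` have one and the same
link `L` in `T₁`, which is nonempty (so that they are faces of cells of `T₁`), and `T₂` arises by
exchanging this triangulation, joined with `L`, for the opposite one, joined with `L`. -/
def IsFlip (p : ι → EuclideanSpace ℝ (Fin d)) (T₁ T₂ : Finset (Finset ι)) : Prop :=
  ∃ P N : Finset ι, IsSignedCircuit p P N ∧
    ∃ L : Finset (Finset ι), L.Nonempty ∧
      (∀ τ ∈ deletions (P ∪ N) P, link T₁ τ = L) ∧
      T₂ = (T₁ \ Finset.image₂ (· ∪ ·) L (deletions (P ∪ N) P)) ∪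
        Finset.image₂ (· ∪ ·) L (deletions (P ∪ N) N)

/-- The graph of triangulations (graph of flips): its vertices are all triangulations of the
configuration, and its edges are the geometric bistellar flips between them. -/
def flipGraph (p : ι → EuclideanSpace ℝ (Fin d)) :
    SimpleGraph {T : Finset (Finset ι) // IsTriangulation p T} :=
  SimpleGraph.fromRel fun T₁ T₂ => IsFlip p T₁.1 T₂.1

end PointConfiguration

/-! The obstruction to connectivity is a family `R` of cells that no flip can remove. In general
position a flip has a circuit `C = P ∪ N` with `d + 2` elements and replaces the cells `C \ {c}`, `c
∈ P`, by those with `c ∈ N`. Let `T ⊇ R` be a triangulation containing all `C \ {c}`, `c ∈ P`, and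
suppose that one of these cells lies in `R`. If `R` is locked (`IsLocked`), then `C \ {c}` has a
vertex `v` whose opposite facet separates `v` from `c`, and the neighbour in `R` across that facet
avoids `c`. The barycentric coordinate of `v`, applied to the affine dependence, shows that `v` has
the same sign as `c`, so `C \ {v}` is in `T` too. It lies across the same facet, hence is that
neighbour, yet it contains `c`: a contradiction (`IsLocked.notMem`). So a locked family persists
along every path of flips (`IsLocked.subset_of_reachable`). It remains to exhibit 17 points, a
triangulation containing a locked family, and a triangulation lacking one of its cells.

That the two explicit lists of cells are triangulations follows from a local criterion,
`IsMatched.isTriangulation`: each facet is on the boundary or has exactly one neighbour, on the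
other side. A generic segment meets the facet hyperplanes one at a time
(`subset_of_forall_mem_nhds`), so being covered, and being covered by two overlapping cells, both
propagate through the interior of the hull. The former gives the covering. The latter is impossible,
since the barycentre of a boundary facet lies in one cell only. The same walk near a face shows that
cells meet face to face.

The finite data are checked by kernel computation: general position by elimination modulo a prime,
and sides of facets by exact integer arithmetic with normal vectors. -/

open Set Filter Topology

namespace PointConfiguration

/-! ### Full-dimensional cells and their barycentric coordinates -/

section Barycentric

variable {d : ℕ} {ι : Type*} {p : ι → EuclideanSpace ℝ (Fin d)} {σ : Finset ι}

/-- A set of labels is a full cell if its points are the vertices of a `d`-simplex. -/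
def IsFullCell (p : ι → EuclideanSpace ℝ (Fin d)) (σ : Finset ι) : Prop :=
  Independent p σ ∧ σ.card = d + 1

theorem IsFullCell.affineSpan_eq_top (h : IsFullCell p σ) :
    affineSpan ℝ (range fun i : σ => p i) = ⊤ := by
  rw [AffineIndependent.affineSpan_eq_top_iff_card_eq_finrank_add_one h.1]
  simp [h.2]

/-- The affine basis formed by the vertices of a full cell. -/
noncomputable def IsFullCell.basis (h : IsFullCell p σ) :
    AffineBasis σ ℝ (EuclideanSpace ℝ (Fin d)) :=
  ⟨fun i : σ => p i, h.1, h.affineSpan_eq_top⟩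

theorem IsFullCell.points_eq_range (h : IsFullCell p σ) : points p σ = range h.basis := by
  rw [points, image_eq_range]
  rfl

open Classical in
/-- The barycentric coordinate of the vertex `i` of the cell `σ`, as an affine map on the whole
space (zero if `σ` is not a full cell or `i` is not one of its vertices). -/
noncomputable def bary (p : ι → EuclideanSpace ℝ (Fin d)) (σ : Finset ι) (i : ι) :
    EuclideanSpace ℝ (Fin d) →ᵃ[ℝ] ℝ :=
  if h : IsFullCell p σ ∧ i ∈ σ then h.1.basis.coord ⟨i, h.2⟩ else 0

theorem bary_eq (h : IsFullCell p σ) (i : σ) : bary p σ i = h.basis.coord i := by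
  rw [bary, dif_pos ⟨h, i.2⟩]

theorem bary_self (h : IsFullCell p σ) {i : ι} (hi : i ∈ σ) : bary p σ i (p i) = 1 := by
  rw [bary_eq h ⟨i, hi⟩]
  exact h.basis.coord_apply_eq ⟨i, hi⟩

theorem bary_ne (h : IsFullCell p σ) {i j : ι} (hi : i ∈ σ) (hj : j ∈ σ) (hij : i ≠ j) :
    bary p σ i (p j) = 0 := by
  rw [bary_eq h ⟨i, hi⟩]
  exact h.basis.coord_apply_ne (i := ⟨i, hi⟩) (j := ⟨j, hj⟩) (by simpa using hij)

theorem sum_bary (h : IsFullCell p σ) (x : EuclideanSpace ℝ (Fin d)) :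
    ∑ i ∈ σ, bary p σ i x = 1 := by
  rw [← Finset.sum_coe_sort σ, ← h.basis.sum_coord_apply_eq_one x]
  exact Finset.sum_congr rfl fun i _ => by rw [bary_eq h i]

theorem sum_bary_smul (h : IsFullCell p σ) (x : EuclideanSpace ℝ (Fin d)) :
    ∑ i ∈ σ, bary p σ i x • p i = x := by
  rw [← Finset.sum_coe_sort σ]
  conv_rhs => rw [← h.basis.linear_combination_coord_eq_self x]
  exact Finset.sum_congr rfl fun i _ => by rw [bary_eq h i]; rfl

/-- An affine function is determined by its values at the vertices of a full cell. -/
theorem affine_eq_sum_bary (h : IsFullCell p σ) (g : EuclideanSpace ℝ (Fin d) →ᵃ[ℝ] ℝ)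
    (x : EuclideanSpace ℝ (Fin d)) : g x = ∑ i ∈ σ, bary p σ i x * g (p i) := by
  have key : ∀ y, g y = g.linear y + g 0 := fun y => by
    simpa using congrFun g.decomp y
  rw [key x]
  conv_lhs => rw [← sum_bary_smul h x]
  simp only [map_sum, map_smul, smul_eq_mul]
  have : g 0 = ∑ i ∈ σ, bary p σ i x * g 0 := by rw [← Finset.sum_mul, sum_bary h, one_mul]
  rw [this, ← Finset.sum_add_distrib]
  refine Finset.sum_congr rfl fun i _ => ?_
  rw [key (p i)]
  ring

theorem convexHull_points_eq (h : IsFullCell p σ) :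
    convexHull ℝ (points p σ) = {x | ∀ i ∈ σ, 0 ≤ bary p σ i x} := by
  have h1 := h.points_eq_range
  rw [h1, h.basis.convexHull_eq_nonneg_coord]
  ext x
  simp only [mem_ofPred_eq, Subtype.forall]
  exact forall₂_congr fun i hi => by rw [← bary_eq h ⟨i, hi⟩]

theorem interior_convexHull_points_eq (h : IsFullCell p σ) :
    interior (convexHull ℝ (points p σ)) = {x | ∀ i ∈ σ, 0 < bary p σ i x} := by
  have h1 := h.points_eq_range
  rw [h1, h.basis.interior_convexHull]
  ext x
  simp only [mem_ofPred_eq, Subtype.forall]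
  exact forall₂_congr fun i hi => by rw [← bary_eq h ⟨i, hi⟩]

theorem continuous_bary (i : ι) : Continuous (bary p σ i) :=
  AffineMap.continuous_of_finiteDimensional _

theorem isClosed_convexHull_points (σ : Finset ι) : IsClosed (convexHull ℝ (points p σ)) :=
  ((σ.finite_toSet.image p).isCompact_convexHull ℝ).isClosed

theorem mem_convexHull_points (h : IsFullCell p σ) {x : EuclideanSpace ℝ (Fin d)} :
    x ∈ convexHull ℝ (points p σ) ↔ ∀ i ∈ σ, 0 ≤ bary p σ i x := by
  rw [convexHull_points_eq h, mem_ofPred_eq]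

theorem mem_interior_convexHull_points (h : IsFullCell p σ) {x : EuclideanSpace ℝ (Fin d)} :
    x ∈ interior (convexHull ℝ (points p σ)) ↔ ∀ i ∈ σ, 0 < bary p σ i x := by
  rw [interior_convexHull_points_eq h, mem_ofPred_eq]

theorem nonempty_interior_convexHull_points (h : IsFullCell p σ) :
    (interior (convexHull ℝ (points p σ))).Nonempty := by
  have h1 := h.points_eq_range
  rw [h1, interior_convexHull_nonempty_iff_affineSpan_eq_top]
  exact h.basis.tot

theorem convexHull_points_subset_closure (h : IsFullCell p σ) :
    convexHull ℝ (points p σ) ⊆ closure (interior (convexHull ℝ (points p σ))) :=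
  ((convex_convexHull ℝ _).closure_interior_eq_closure_of_nonempty_interior
    (nonempty_interior_convexHull_points h)).symm ▸ subset_closure

variable [DecidableEq ι]

/-- A point off the facet `σ.erase v` in a configuration in general position is not on the
hyperplane of that facet. -/
theorem bary_ne_zero (gp : GeneralPosition p) (h : IsFullCell p σ) {v i : ι} (hv : v ∈ σ)
    (hi : i ∉ σ.erase v) : bary p σ v (p i) ≠ 0 := by
  intro h0
  have hc : (insert i (σ.erase v)).card = d + 1 := by
    rw [Finset.card_insert_of_notMem hi, Finset.card_erase_of_mem hv, h.2]
    simp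
  have hρ : IsFullCell p (insert i (σ.erase v)) := ⟨gp _ hc, hc⟩
  -- The coordinate would vanish at every vertex of the full cell `insert i (σ.erase v)`, hence
  -- everywhere, although it is 1 at `p v`.
  have h1 := affine_eq_sum_bary hρ (bary p σ v) (p v)
  rw [bary_self h hv, Finset.sum_eq_zero] at h1
  · exact one_ne_zero h1
  · intro j hj
    rcases Finset.mem_insert.1 hj with rfl | hj
    · rw [h0, mul_zero]
    · rw [bary_ne h hv (Finset.mem_of_mem_erase hj) (Finset.ne_of_mem_erase hj).symm, mul_zero]

/-- An affine function vanishing on a facet is a multiple of a barycentric coordinate. -/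
theorem affine_eq_bary_mul (h : IsFullCell p σ) {v : ι} (hv : v ∈ σ)
    {g : EuclideanSpace ℝ (Fin d) →ᵃ[ℝ] ℝ} (hg : ∀ i ∈ σ.erase v, g (p i) = 0)
    (x : EuclideanSpace ℝ (Fin d)) : g x = bary p σ v x * g (p v) := by
  rw [affine_eq_sum_bary h g x, ← Finset.add_sum_erase σ _ hv,
    Finset.sum_eq_zero (fun i hi => by rw [hg i hi, mul_zero]), add_zero]

/-- On the hyperplane of a facet, the barycentric coordinates do not depend on the cell. -/
theorem bary_eq_of_bary_eq_zero {σ' : Finset ι} (h : IsFullCell p σ) (h' : IsFullCell p σ')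
    {v : ι} (hv : v ∈ σ) (hs : σ.erase v ⊆ σ') {z : EuclideanSpace ℝ (Fin d)}
    (hz : bary p σ v z = 0) {i : ι} (hi : i ∈ σ') :
    bary p σ' i z = if i ∈ σ.erase v then bary p σ i z else 0 := by
  rw [affine_eq_sum_bary h (bary p σ' i) z, ← Finset.add_sum_erase σ _ hv, hz, zero_mul, zero_add]
  split_ifs with h1
  · rw [Finset.sum_eq_single i, bary_self h' hi, mul_one]
    · intro j hj hji
      rw [bary_ne h' hi (hs hj) hji.symm, mul_zero]
    · exact fun h2 => absurd h1 h2
  · refine Finset.sum_eq_zero fun j hj => ?_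
    rw [bary_ne h' hi (hs hj) (fun hij => h1 (hij ▸ hj)), mul_zero]

end Barycentric

/-! ### Walking through a convex open set while avoiding intersections of hyperplanes -/

section Walking

variable {E : Type*} [NormedAddCommGroup E] [NormedSpace ℝ E] [FiniteDimensional ℝ E]

/-- A nonempty open set is not covered by finitely many hyperplanes. -/
theorem exists_mem_forall_affine_ne_zero {κ : Type*} [Finite κ] (h : κ → E →ᵃ[ℝ] ℝ)
    (hne : ∀ k, ∃ x, h k x ≠ 0) {U : Set E} (hU : IsOpen U) (hUn : U.Nonempty) :
    ∃ x ∈ U, ∀ k, h k x ≠ 0 := by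
  have hd : ∀ k, Dense {x | h k x ≠ 0} := by
    intro k x
    obtain ⟨y, hy⟩ := hne k
    by_cases hx : h k x = 0
    · have ht : Tendsto (fun t : ℝ => AffineMap.lineMap x y t) (𝓝[≠] 0) (𝓝 x) := by
        have : Continuous fun t : ℝ => AffineMap.lineMap x y t := AffineMap.lineMap_continuous
        have h2 := this.tendsto 0
        rw [AffineMap.lineMap_apply_zero] at h2
        exact h2.mono_left nhdsWithin_le_nhds
      refine mem_closure_of_tendsto ht ?_
      filter_upwards [self_mem_nhdsWithin] with t ht
      rw [AffineMap.apply_lineMap, AffineMap.lineMap_apply, hx]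
      simpa using ⟨ht, hy⟩
    · exact subset_closure hx
  have ho : ∀ k, IsOpen {x | h k x ≠ 0} := fun k =>
    isOpen_ne_fun (AffineMap.continuous_of_finiteDimensional _) continuous_const
  have := dense_iInter_of_isOpen ho hd
  obtain ⟨x, hxU, hx⟩ := this.inter_open_nonempty U hU hUn
  exact ⟨x, hxU, by simpa using hx⟩

/-- A closed set `W` that meets a convex open set `G` in its interior, and that is a neighbourhood
of all its points in `G` that lie in at most one of finitely many hyperplanes, contains `G`.
Hyperplanes with the same label count as one. -/
theorem subset_of_forall_mem_nhds {κ l : Type*} [Finite κ] (h : κ → E →ᵃ[ℝ] ℝ) (f : κ → l)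
    (hne : ∀ k, ∃ x, h k x ≠ 0) (hpair : ∀ k k', f k ≠ f k' → ∃ x, h k x = 0 ∧ h k' x ≠ 0)
    {G W : Set E} (hG : IsOpen G) (hGc : Convex ℝ G) (hW : IsClosed W)
    (hloc : ∀ z ∈ W ∩ G, (∀ k k', h k z = 0 → h k' z = 0 → f k = f k') → W ∈ 𝓝 z)
    (hn : (G ∩ interior W).Nonempty) : G ⊆ W := by
  intro x0 hx0
  by_contra hx0W
  obtain ⟨x, ⟨hxG, hxW⟩, hx⟩ := exists_mem_forall_affine_ne_zero h hne (hG.sdiff hW) ⟨x0, hx0, hx0W⟩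
  -- The zero set of this function is the hyperplane through `x` and the intersection of the two
  -- given hyperplanes. A segment from `x` to a point `y` off it never meets both of them at once.
  let h2 : {k : κ × κ // f k.1 ≠ f k.2} → E →ᵃ[ℝ] ℝ := fun k =>
    (h k.1.2 x) • (h k.1.1) - (h k.1.1 x) • (h k.1.2)
  have hne2 : ∀ k, ∃ y, h2 k y ≠ 0 := by
    rintro ⟨⟨k, k'⟩, hk⟩
    obtain ⟨y, hy, hy'⟩ := hpair k k' hk
    refine ⟨y, ?_⟩
    simp [h2, hy, hy', hx k]
  obtain ⟨y, ⟨hyG, hyW⟩, hy⟩ :=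
    exists_mem_forall_affine_ne_zero h2 hne2 (hG.inter isOpen_interior) hn
  have hcont : Continuous fun t : ℝ => AffineMap.lineMap x y t := AffineMap.lineMap_continuous
  have hmemG : ∀ t ∈ Icc (0 : ℝ) 1, AffineMap.lineMap x y t ∈ G := fun t ht =>
    hGc.segment_subset hxG hyG (by
      rw [segment_eq_image_lineMap]; exact mem_image_of_mem _ ht)
  have hgen : ∀ t : ℝ, ∀ k k', h k (AffineMap.lineMap x y t) = 0 →
      h k' (AffineMap.lineMap x y t) = 0 → f k = f k' := by
    intro t k k' h0 h0'
    by_contra hk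
    rw [AffineMap.apply_lineMap, AffineMap.lineMap_apply] at h0 h0'
    have e1 : t * (h k y - h k x) + h k x = 0 := by simpa using h0
    have e2 : t * (h k' y - h k' x) + h k' x = 0 := by simpa using h0'
    have e3 : h k' x * h k y - h k x * h k' y ≠ 0 := by simpa [h2] using hy ⟨(k, k'), hk⟩
    have e4 : t * (h k' x * h k y - h k x * h k' y) = 0 := by
      linear_combination (h k' x) * e1 - (h k x) * e2
    rcases mul_eq_zero.1 e4 with rfl | e4
    · exact hx k (by simpa using e1)
    · exact e3 e4
  -- The parameters that land in `interior W` are open and, by `hloc`, relatively closed in the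
  -- interval; `t = 1` is one of them, so `t = 0` is too.
  have hsub : Icc (0 : ℝ) 1 ⊆ (fun t : ℝ => AffineMap.lineMap x y t) ⁻¹' (interior W) := by
    refine isPreconnected_Icc.subset_of_closure_inter_subset (isOpen_interior.preimage hcont)
      ⟨1, by simp, by simpa using hyW⟩ ?_
    rintro t ⟨ht, htI⟩
    have htW : AffineMap.lineMap x y t ∈ W := by
      have h3 : IsClosed ((fun t : ℝ => AffineMap.lineMap x y t) ⁻¹' W) := hW.preimage hcont
      exact h3.closure_subset_iff.2 (preimage_mono interior_subset) ht
    exact mem_interior_iff_mem_nhds.2 (hloc _ ⟨htW, hmemG t htI⟩ (hgen t))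
  have := hsub (show (0 : ℝ) ∈ Icc (0 : ℝ) 1 by simp)
  exact hxW (interior_subset (by simpa using this))

end Walking

/-! ### A local criterion for triangulations -/

section Criterion

variable {d : ℕ} {ι : Type*} {p : ι → EuclideanSpace ℝ (Fin d)}
  {T : Finset (Finset ι)} {σ σ' : Finset ι}

theorem convexHull_points_subset (σ : Finset ι) :
    convexHull ℝ (points p σ) ⊆ convexHull ℝ (range p) :=
  convexHull_mono (image_subset_range _ _)

theorem bary_nonneg_of_mem_convexHull {S : Set (EuclideanSpace ℝ (Fin d))}
    {g : EuclideanSpace ℝ (Fin d) →ᵃ[ℝ] ℝ} (hg : ∀ x ∈ S, 0 ≤ g x) :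
    ∀ x ∈ convexHull ℝ S, 0 ≤ g x := by
  have : Convex ℝ (g ⁻¹' Ici 0) := (convex_Ici 0).affine_preimage g
  exact fun x hx => convexHull_min (fun y hy => hg y hy) this hx

/-- A nonconstant affine function that is nonnegative on a set is positive on its interior. -/
theorem affine_pos_of_mem_interior {S : Set (EuclideanSpace ℝ (Fin d))}
    {g : EuclideanSpace ℝ (Fin d) →ᵃ[ℝ] ℝ} (hg : ∀ x ∈ S, 0 ≤ g x)
    {a z : EuclideanSpace ℝ (Fin d)} (ha : g a ≠ g z) (hz : z ∈ interior S) : 0 < g z := by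
  refine (hg z (interior_subset hz)).lt_of_ne fun h0 => ?_
  have hc : Continuous fun t : ℝ => AffineMap.lineMap z a t := AffineMap.lineMap_continuous
  have hev : ∀ᶠ t in 𝓝 (0 : ℝ), AffineMap.lineMap z a t ∈ interior S :=
    hc.continuousAt.eventually_mem (isOpen_interior.mem_nhds (by simpa using hz))
  obtain ⟨ε, hε, hball⟩ := Metric.eventually_nhds_iff.1 hev
  have key : ∀ t : ℝ, |t| < ε → 0 ≤ t * g a := by
    intro t ht
    have h1 := hg _ (interior_subset (hball (by simpa using ht)))
    rw [AffineMap.apply_lineMap, AffineMap.lineMap_apply, ← h0] at h1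
    simpa using h1
  -- Moving both towards `a` and away from it keeps `g` nonnegative, which forces `g a = 0`.
  have h1 := key (ε / 2) (by rw [abs_of_pos (by linarith)]; linarith)
  have h2 := key (-(ε / 2)) (by rw [abs_neg, abs_of_pos (by linarith)]; linarith)
  have h3 : ε / 2 * g a = 0 := by linarith
  rcases mul_eq_zero.1 h3 with h3 | h3
  · linarith
  · exact ha (by rw [h3, h0])

theorem exists_bary_eq_zero (hσ : IsFullCell p σ) {z : EuclideanSpace ℝ (Fin d)}
    (hz : z ∈ convexHull ℝ (points p σ)) (hzi : z ∉ interior (convexHull ℝ (points p σ))) :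
    ∃ v ∈ σ, bary p σ v z = 0 := by
  rw [mem_interior_convexHull_points hσ] at hzi
  push Not at hzi
  obtain ⟨v, hv, h⟩ := hzi
  exact ⟨v, hv, le_antisymm h ((mem_convexHull_points hσ).1 hz v hv)⟩

theorem interior_nonempty_of_mem (hT : ∀ σ ∈ T, IsFullCell p σ) (hσ : σ ∈ T) :
    (interior (convexHull ℝ (range p)) ∩ interior (convexHull ℝ (points p σ))).Nonempty := by
  obtain ⟨y, hy⟩ := nonempty_interior_convexHull_points (hT σ hσ)
  exact ⟨y, interior_mono (convexHull_points_subset σ) hy, hy⟩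

variable [DecidableEq ι]

/-- Every facet of a cell of `T` either supports the whole configuration and is in no other cell,
or is in exactly one other cell, which lies on the other side. -/
def IsMatched (p : ι → EuclideanSpace ℝ (Fin d)) (T : Finset (Finset ι)) : Prop :=
  ∀ σ ∈ T, ∀ v ∈ σ, ∃ g : EuclideanSpace ℝ (Fin d) →ᵃ[ℝ] ℝ,
    (∀ i ∈ σ.erase v, g (p i) = 0) ∧ 0 < g (p v) ∧
      (((∀ i, i ∉ σ.erase v → 0 < g (p i)) ∧ ∀ ρ ∈ T, σ.erase v ⊆ ρ → ρ = σ) ∨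
        ∃ σ' ∈ T, σ.erase v ⊆ σ' ∧ (∀ j ∈ σ', j ∉ σ.erase v → g (p j) < 0) ∧
          ∀ ρ ∈ T, σ.erase v ⊆ ρ → ρ = σ ∨ ρ = σ')

/-- `σ` and `σ'` share a facet, `σ.erase v = σ'.erase w`, and lie on different sides of it. -/
structure AreOpposite (p : ι → EuclideanSpace ℝ (Fin d)) (σ : Finset ι) (v : ι) (σ' : Finset ι)
    (w : ι) : Prop where
  full : IsFullCell p σ
  full' : IsFullCell p σ'
  mem : v ∈ σ
  mem' : w ∈ σ'
  erase_eq : σ'.erase w = σ.erase v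
  neg : bary p σ v (p w) < 0

/-- Both coordinates vanish on the hyperplane of the common facet, so they are proportional.
Evaluation at `p w` gives the sign of the factor. -/
theorem AreOpposite.bary_eq_mul {v w : ι} (h : AreOpposite p σ v σ' w) :
    ∃ c : ℝ, c < 0 ∧ ∀ x, bary p σ' w x = bary p σ v x * c := by
  have key : ∀ x, bary p σ' w x = bary p σ v x * bary p σ' w (p v) :=
    affine_eq_bary_mul h.full h.mem fun i hi => by
      rw [← h.erase_eq] at hi
      exact bary_ne h.full' h.mem' (Finset.mem_of_mem_erase hi) (Finset.ne_of_mem_erase hi).symm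
  refine ⟨_, ?_, key⟩
  have h1 := key (p w)
  rw [bary_self h.full' h.mem'] at h1
  nlinarith [h.neg]

/-- Near a point in the relative interior of their common facet, two opposite cells fill the two
sides of its hyperplane. -/
theorem AreOpposite.eventually {v w : ι} (h : AreOpposite p σ v σ' w)
    {z : EuclideanSpace ℝ (Fin d)} (hz : bary p σ v z = 0)
    (hpos : ∀ i ∈ σ.erase v, 0 < bary p σ i z) :
    ∀ᶠ y in 𝓝 z, (0 ≤ bary p σ v y → y ∈ convexHull ℝ (points p σ)) ∧
      (bary p σ v y ≤ 0 → y ∈ convexHull ℝ (points p σ')) ∧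
      (bary p σ v y < 0 → y ∈ interior (convexHull ℝ (points p σ'))) := by
  obtain ⟨c, hc, hcx⟩ := h.bary_eq_mul
  have h1 : ∀ᶠ y in 𝓝 z, ∀ i ∈ σ.erase v, 0 < bary p σ i y :=
    (Finset.eventually_all _).2 fun i hi =>
      (continuous_bary i).continuousAt.eventually (lt_mem_nhds (hpos i hi))
  have h2 : ∀ᶠ y in 𝓝 z, ∀ i ∈ σ.erase v, 0 < bary p σ' i y := by
    refine (Finset.eventually_all _).2 fun i hi =>
      (continuous_bary i).continuousAt.eventually (lt_mem_nhds ?_)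
    have hi' : i ∈ σ'.erase w := h.erase_eq ▸ hi
    rw [bary_eq_of_bary_eq_zero h.full h.full' h.mem
      (h.erase_eq ▸ Finset.erase_subset w σ') hz (Finset.mem_of_mem_erase hi'), if_pos hi]
    exact hpos i hi
  filter_upwards [h1, h2] with y hy1 hy2
  rw [mem_convexHull_points h.full, mem_convexHull_points h.full',
    mem_interior_convexHull_points h.full']
  refine ⟨fun hv i hi => ?_, fun hv i hi => ?_, fun hv i hi => ?_⟩
  · by_cases hiv : i = v
    · rwa [hiv]
    · exact (hy1 i (Finset.mem_erase.2 ⟨hiv, hi⟩)).le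
  · by_cases hiw : i = w
    · rw [hiw, hcx]
      exact mul_nonneg_of_nonpos_of_nonpos hv hc.le
    · exact (hy2 i (h.erase_eq ▸ Finset.mem_erase.2 ⟨hiw, hi⟩)).le
  · by_cases hiw : i = w
    · rw [hiw, hcx]
      exact mul_pos_of_neg_of_neg hv hc
    · exact hy2 i (h.erase_eq ▸ Finset.mem_erase.2 ⟨hiw, hi⟩)

/-- A supporting hyperplane contains no interior point of the hull, so the boundary alternative of
the matching condition is excluded by `z`. -/
theorem IsMatched.exists_opposite (hm : IsMatched p T) (hT : ∀ σ ∈ T, IsFullCell p σ)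
    (hσ : σ ∈ T) {v : ι} (hv : v ∈ σ) {z : EuclideanSpace ℝ (Fin d)} (hz : bary p σ v z = 0)
    (hzi : z ∈ interior (convexHull ℝ (range p))) :
    ∃ σ' ∈ T, ∃ w, AreOpposite p σ v σ' w ∧ ∀ ρ ∈ T, σ.erase v ⊆ ρ → ρ = σ ∨ ρ = σ' := by
  obtain ⟨g, hg0, hgv, ⟨hb, -⟩ | ⟨σ', hσ', hs, hneg, huniq⟩⟩ := hm σ hσ v hv
  · exfalso
    have hgx := affine_eq_bary_mul (hT σ hσ) hv hg0
    have h1 : ∀ x ∈ convexHull ℝ (range p), 0 ≤ g x := by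
      refine bary_nonneg_of_mem_convexHull ?_
      rintro _ ⟨i, rfl⟩
      by_cases hi : i ∈ σ.erase v
      · exact (hg0 i hi).ge
      · exact (hb i hi).le
    have h2 : g z = 0 := by rw [hgx, hz, zero_mul]
    have h3 := affine_pos_of_mem_interior h1 (a := p v) (by rw [h2]; exact hgv.ne') hzi
    exact h3.ne' h2
  · have hc : (σ.erase v).card = d := by rw [Finset.card_erase_of_mem hv, (hT σ hσ).2]; simp
    have hc' : (σ' \ σ.erase v).card = 1 := by
      rw [Finset.card_sdiff_of_subset hs, (hT σ' hσ').2, hc]; simp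
    obtain ⟨w, hw⟩ := Finset.card_eq_one.1 hc'
    have hww : w ∈ σ' ∧ w ∉ σ.erase v := Finset.mem_sdiff.1 (hw ▸ Finset.mem_singleton_self w)
    refine ⟨σ', hσ', w, ⟨hT σ hσ, hT σ' hσ', hv, hww.1, ?_, ?_⟩, huniq⟩
    · refine (Finset.eq_of_subset_of_card_le (fun i hi => Finset.mem_erase.2 ⟨?_, hs hi⟩) ?_).symm
      · rintro rfl
        exact hww.2 hi
      · rw [Finset.card_erase_of_mem hww.1, (hT σ' hσ').2, hc]; simp
    · have h1 := hneg w hww.1 hww.2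
      rw [affine_eq_bary_mul (hT σ hσ) hv hg0] at h1
      by_contra h2
      exact absurd h1 (not_lt.2 (mul_nonneg (not_lt.1 h2) hgv.le))

/-- The point `z` lies on at most one of the hyperplanes spanned by the facets of cells of `T`. -/
def OnAtMostOneFacet (p : ι → EuclideanSpace ℝ (Fin d)) (T : Finset (Finset ι))
    (z : EuclideanSpace ℝ (Fin d)) : Prop :=
  ∀ σ ∈ T, ∀ v ∈ σ, ∀ σ' ∈ T, ∀ v' ∈ σ', bary p σ v z = 0 → bary p σ' v' z = 0 →
    σ.erase v = σ'.erase v'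

theorem OnAtMostOneFacet.bary_pos {z : EuclideanSpace ℝ (Fin d)} (h : OnAtMostOneFacet p T z)
    (hT : ∀ σ ∈ T, IsFullCell p σ) (hσ : σ ∈ T) {v : ι} (hv : v ∈ σ) (hz : bary p σ v z = 0)
    (hzσ : z ∈ convexHull ℝ (points p σ)) : ∀ i ∈ σ.erase v, 0 < bary p σ i z := by
  intro i hi
  refine ((mem_convexHull_points (hT σ hσ)).1 hzσ i (Finset.mem_of_mem_erase hi)).lt_of_ne
    fun h0 => ?_
  have h1 := h σ hσ v hv σ hσ i (Finset.mem_of_mem_erase hi) hz h0.symm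
  rw [h1] at hi
  exact Finset.notMem_erase i σ hi

/-- The walking lemma for the facet hyperplanes, labelled by their vertex sets. By general position,
distinct facets span distinct hyperplanes: a vertex of one is off the hyperplane of the other. -/
theorem subset_of_forall_onAtMostOneFacet (gp : GeneralPosition p)
    (hT : ∀ σ ∈ T, IsFullCell p σ) {G W : Set (EuclideanSpace ℝ (Fin d))} (hG : IsOpen G)
    (hGc : Convex ℝ G) (hW : IsClosed W)
    (hloc : ∀ z ∈ W, z ∈ G → OnAtMostOneFacet p T z → W ∈ 𝓝 z)
    (hn : (G ∩ interior W).Nonempty) : G ⊆ W := by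
  let κ := {k : T × ι // k.2 ∈ k.1.1}
  have : Finite κ := by
    refine Finite.of_injective
      (fun k : κ => (⟨k.1.1, ⟨k.1.2, k.2⟩⟩ : Σ σ : T, {v : ι // v ∈ σ.1})) ?_
    rintro ⟨⟨a, b⟩, h⟩ ⟨⟨a', b'⟩, h'⟩ hab
    simp only [Sigma.mk.injEq] at hab
    obtain ⟨rfl, hab⟩ := hab
    obtain rfl : b = b' := by simpa using hab
    rfl
  refine subset_of_forall_mem_nhds (fun k : κ => bary p k.1.1 k.1.2)
    (fun k => k.1.1.1.erase k.1.2) ?_ ?_ hG hGc hW ?_ hn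
  · intro k
    exact ⟨p k.1.2, by rw [bary_self (hT _ k.1.1.2) k.2]; exact one_ne_zero⟩
  · intro k k' hk
    have hc : ∀ k : κ, (k.1.1.1.erase k.1.2).card = d := fun k => by
      rw [Finset.card_erase_of_mem k.2, (hT _ k.1.1.2).2]; simp
    have : ¬ k.1.1.1.erase k.1.2 ⊆ k'.1.1.1.erase k'.1.2 := fun hs =>
      hk (Finset.eq_of_subset_of_card_le hs (by rw [hc, hc]))
    obtain ⟨i, hi, hi'⟩ := Finset.not_subset.1 this
    exact ⟨p i, bary_ne (hT _ k.1.1.2) k.2 (Finset.mem_of_mem_erase hi)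
      (Finset.ne_of_mem_erase hi).symm, bary_ne_zero gp (hT _ k'.1.1.2) k'.2 hi'⟩
  · rintro z ⟨hzW, hzG⟩ hgen
    refine hloc z hzW hzG ?_
    intro σ hσ v hv σ' hσ' v' hv' h h'
    exact hgen ⟨(⟨σ, hσ⟩, v), hv⟩ ⟨(⟨σ', hσ'⟩, v'), hv'⟩ h h'

/-- A point in the interior of the whole configuration, on at most one facet hyperplane, that is
in a cell of a matched family, has a neighbourhood covered by cells containing that facet. -/
theorem IsMatched.nhds_of_mem (hm : IsMatched p T) (hT : ∀ σ ∈ T, IsFullCell p σ)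
    (hσ : σ ∈ T) {z : EuclideanSpace ℝ (Fin d)} (hz : z ∈ convexHull ℝ (points p σ))
    (hzi : z ∈ interior (convexHull ℝ (range p))) (hgen : OnAtMostOneFacet p T z)
    {W : Set (EuclideanSpace ℝ (Fin d))}
    (hW : ∀ ρ ∈ T, (ρ = σ ∨ ∃ v ∈ σ, bary p σ v z = 0 ∧ σ.erase v ⊆ ρ) →
      convexHull ℝ (points p ρ) ⊆ W) : W ∈ 𝓝 z := by
  by_cases hzσ : z ∈ interior (convexHull ℝ (points p σ))
  · exact mem_of_superset (mem_interior_iff_mem_nhds.1 hzσ) (hW σ hσ (Or.inl rfl))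
  · obtain ⟨v, hv, h0⟩ := exists_bary_eq_zero (hT σ hσ) hz hzσ
    obtain ⟨σ', hσ', w, hop, -⟩ := hm.exists_opposite hT hσ hv h0 hzi
    filter_upwards [hop.eventually h0 (hgen.bary_pos hT hσ hv h0 hz)] with y hy
    rcases le_total 0 (bary p σ v y) with h | h
    · exact hW σ hσ (Or.inl rfl) (hy.1 h)
    · exact hW σ' hσ' (Or.inr ⟨v, hv, h0, hop.erase_eq ▸ Finset.erase_subset w σ'⟩) (hy.2.1 h)

/-- The cells of a nonempty matched family cover the convex hull of the configuration. -/
theorem IsMatched.cover [Finite ι] (hm : IsMatched p T) (gp : GeneralPosition p)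
    (hT : ∀ σ ∈ T, IsFullCell p σ) (hne : T.Nonempty) :
    ⋃ σ ∈ T, convexHull ℝ (points p σ) = convexHull ℝ (range p) := by
  refine Subset.antisymm (iUnion₂_subset fun σ _ => convexHull_points_subset σ) ?_
  have hclosed : IsClosed (⋃ σ ∈ T, convexHull ℝ (points p σ)) :=
    T.finite_toSet.isClosed_biUnion fun σ _ => isClosed_convexHull_points σ
  obtain ⟨σ, hσ⟩ := hne
  have hint := interior_nonempty_of_mem hT hσ
  have hsub : interior (convexHull ℝ (range p)) ⊆ ⋃ σ ∈ T, convexHull ℝ (points p σ) := by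
    refine subset_of_forall_onAtMostOneFacet gp hT isOpen_interior
      (convex_convexHull ℝ _).interior hclosed ?_
      (hint.mono (inter_subset_inter_right _
        (interior_mono (subset_biUnion_of_mem (u := fun σ => convexHull ℝ (points p σ)) hσ))))
    intro z hz hzi hgen
    obtain ⟨σ, hσ, hzσ⟩ := mem_iUnion₂.1 hz
    exact hm.nhds_of_mem hT hσ hzσ hzi hgen fun ρ hρ _ =>
      subset_biUnion_of_mem (u := fun σ => convexHull ℝ (points p σ)) hρ
  have h1 := closure_minimal hsub hclosed
  rw [(convex_convexHull ℝ _).closure_interior_eq_closure_of_nonempty_interior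
    (hint.mono inter_subset_left)] at h1
  exact subset_closure.trans h1

end Criterion

/-! ### Matched families do not overlap and meet face to face -/

section Criterion

variable {d : ℕ} {ι : Type*} {p : ι → EuclideanSpace ℝ (Fin d)}
  {T : Finset (Finset ι)} {σ σ' : Finset ι}

theorem affine_sum_smul {s : Finset ι} {w : ι → ℝ} (hw : ∑ i ∈ s, w i = 1)
    (g : EuclideanSpace ℝ (Fin d) →ᵃ[ℝ] ℝ) :
    g (∑ i ∈ s, w i • p i) = ∑ i ∈ s, w i * g (p i) := by
  have key : ∀ y, g y = g.linear y + g 0 := fun y => by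
    simpa using congrFun g.decomp y
  rw [key]
  have : g 0 = ∑ i ∈ s, w i * g 0 := by rw [← Finset.sum_mul, hw, one_mul]
  rw [this, map_sum, ← Finset.sum_add_distrib]
  refine Finset.sum_congr rfl fun i _ => ?_
  rw [key (p i), map_smul, smul_eq_mul]
  ring

/-- `σ` and `σ'` are distinct and have common interior points. -/
def Overlap (p : ι → EuclideanSpace ℝ (Fin d)) (σ σ' : Finset ι) : Prop :=
  σ ≠ σ' ∧ (interior (convexHull ℝ (points p σ)) ∩
    interior (convexHull ℝ (points p σ'))).Nonempty

theorem Overlap.symm (h : Overlap p σ σ') : Overlap p σ' σ :=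
  ⟨h.1.symm, by rw [inter_comm]; exact h.2⟩

theorem IsFullCell.affineSpan_points (h : IsFullCell p σ) : affineSpan ℝ (points p σ) = ⊤ := by
  rw [h.points_eq_range]
  exact h.basis.tot

variable [DecidableEq ι]

theorem AreOpposite.disjoint {v w : ι} (h : AreOpposite p σ v σ' w) :
    Disjoint (interior (convexHull ℝ (points p σ))) (interior (convexHull ℝ (points p σ'))) := by
  refine Set.disjoint_left.2 fun y hy hy' => ?_
  obtain ⟨c, hc, hcx⟩ := h.bary_eq_mul
  have h1 := (mem_interior_convexHull_points h.full).1 hy v h.mem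
  have h2 := (mem_interior_convexHull_points h.full').1 hy' w h.mem'
  rw [hcx] at h2
  nlinarith

/-- Moving `z` slightly in the direction away from `p v` leads across the facet into the opposite
cell. -/
theorem AreOpposite.exists_mem_interior {v w : ι} (h : AreOpposite p σ v σ' w)
    {z : EuclideanSpace ℝ (Fin d)} (hz : bary p σ v z = 0)
    (hpos : ∀ i ∈ σ.erase v, 0 < bary p σ i z) {U : Set (EuclideanSpace ℝ (Fin d))}
    (hU : U ∈ 𝓝 z) : (U ∩ interior (convexHull ℝ (points p σ'))).Nonempty := by
  have hc : Continuous fun t : ℝ => AffineMap.lineMap z (p v) t := AffineMap.lineMap_continuous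
  have ht : Tendsto (fun t : ℝ => AffineMap.lineMap z (p v) t) (𝓝[<] 0) (𝓝 z) := by
    have h2 := hc.tendsto 0
    rw [AffineMap.lineMap_apply_zero] at h2
    exact h2.mono_left nhdsWithin_le_nhds
  have hev : ∀ᶠ t in 𝓝[<] (0 : ℝ), AffineMap.lineMap z (p v) t ∈
      U ∩ interior (convexHull ℝ (points p σ')) := by
    filter_upwards [ht.eventually hU, ht.eventually (h.eventually hz hpos), self_mem_nhdsWithin]
      with t h1 h2 h3
    refine ⟨h1, h2.2.2 ?_⟩
    rw [AffineMap.apply_lineMap, AffineMap.lineMap_apply, hz, bary_self h.full h.mem]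
    simpa using h3
  obtain ⟨t, ht⟩ := hev.exists
  exact ⟨_, ht⟩

/-- Overlaps propagate across a facet of one of the two cells. -/
theorem IsMatched.nhds_of_mem_interior (hm : IsMatched p T) (hT : ∀ σ ∈ T, IsFullCell p σ)
    (hσ' : σ' ∈ T) {z : EuclideanSpace ℝ (Fin d)}
    (hz : z ∈ interior (convexHull ℝ (points p σ))) (hz' : z ∈ convexHull ℝ (points p σ'))
    (hzi : z ∈ interior (convexHull ℝ (range p))) (hgen : OnAtMostOneFacet p T z)
    (hσ : IsFullCell p σ) (ho : Overlap p σ σ') {W : Set (EuclideanSpace ℝ (Fin d))}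
    (hW : ∀ ρ ∈ T, Overlap p σ ρ →
      convexHull ℝ (points p σ) ∩ convexHull ℝ (points p ρ) ⊆ W) : W ∈ 𝓝 z := by
  have hn : convexHull ℝ (points p σ) ∈ 𝓝 z := mem_interior_iff_mem_nhds.1 hz
  by_cases hzσ : z ∈ interior (convexHull ℝ (points p σ'))
  · exact mem_of_superset (inter_mem hn (mem_interior_iff_mem_nhds.1 hzσ)) (hW σ' hσ' ho)
  · obtain ⟨v, hv, h0⟩ := exists_bary_eq_zero (hT σ' hσ') hz' hzσ
    obtain ⟨ρ, hρ, w, hop, -⟩ := hm.exists_opposite hT hσ' hv h0 hzi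
    have hpos := hgen.bary_pos hT hσ' hv h0 hz'
    have hoρ : Overlap p σ ρ := by
      refine ⟨?_, hop.exists_mem_interior h0 hpos (isOpen_interior.mem_nhds hz)⟩
      rintro rfl
      have h1 := (mem_interior_convexHull_points hσ).1 hz w hop.mem'
      obtain ⟨c, -, hc⟩ := hop.bary_eq_mul
      rw [hc, h0, zero_mul] at h1
      exact lt_irrefl _ h1
    filter_upwards [hop.eventually h0 hpos, hn] with y hy hyσ
    rcases le_total 0 (bary p σ' v y) with h | h
    · exact hW σ' hσ' ho ⟨hyσ, hy.1 h⟩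
    · exact hW ρ hρ hoρ ⟨hyσ, hy.2.1 h⟩

/-- Every cell of `T` that contains the barycentre of a boundary facet contains the facet. -/
theorem exists_forall_mem_subset (hd : 0 < d) (hT : ∀ σ ∈ T, IsFullCell p σ) (hσ : σ ∈ T) {v : ι}
    (hv : v ∈ σ) {g : EuclideanSpace ℝ (Fin d) →ᵃ[ℝ] ℝ} (hg0 : ∀ i ∈ σ.erase v, g (p i) = 0)
    (hgpos : ∀ i, i ∉ σ.erase v → 0 < g (p i)) :
    ∃ z ∈ convexHull ℝ (range p), ∀ ρ ∈ T, z ∈ convexHull ℝ (points p ρ) → σ.erase v ⊆ ρ := by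
  have hd' : (0 : ℝ) < d := Nat.cast_pos.2 hd
  have hw : ∑ i ∈ σ.erase v, (1 / d : ℝ) = 1 := by
    rw [Finset.sum_const, Finset.card_erase_of_mem hv, (hT σ hσ).2]
    simp [hd'.ne']
  refine ⟨∑ i ∈ σ.erase v, (1 / d : ℝ) • p i,
    (convex_convexHull ℝ _).sum_mem (fun _ _ => by positivity) hw
      fun i _ => subset_convexHull ℝ _ (mem_range_self i), ?_⟩
  set z := ∑ i ∈ σ.erase v, (1 / d : ℝ) • p i
  intro ρ hρ hz k hk
  by_contra hkρ
  have hgz : g z = 0 := by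
    rw [affine_sum_smul hw]
    exact Finset.sum_eq_zero fun i hi => by rw [hg0 i hi, mul_zero]
  have hkz : 0 < bary p σ k z := by
    have hkσ := Finset.mem_of_mem_erase hk
    rw [affine_sum_smul hw, Finset.sum_eq_single k, bary_self (hT σ hσ) hkσ]
    · simpa using hd
    · intro i hi hik
      rw [bary_ne (hT σ hσ) hkσ (Finset.mem_of_mem_erase hi) hik.symm, mul_zero]
    · exact fun h => absurd hk h
  have hnn := (mem_convexHull_points (hT ρ hρ)).1 hz
  have hg : ∀ i, 0 ≤ g (p i) := fun i => by
    by_cases hi : i ∈ σ.erase v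
    · exact (hg0 i hi).ge
    · exact (hgpos i hi).le
  rw [affine_eq_sum_bary (hT ρ hρ),
    Finset.sum_eq_zero_iff_of_nonneg fun i hi => mul_nonneg (hnn i hi) (hg i)] at hgz
  rw [affine_eq_sum_bary (hT ρ hρ), Finset.sum_eq_zero] at hkz
  · exact lt_irrefl _ hkz
  · intro i hi
    by_cases hiτ : i ∈ σ.erase v
    · have hik : k ≠ i := fun h => hkρ (h ▸ hi)
      rw [bary_ne (hT σ hσ) (Finset.mem_of_mem_erase hk) (Finset.mem_of_mem_erase hiτ) hik,
        mul_zero]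
    · rw [(mul_eq_zero.1 (hgz i hi)).resolve_right (hgpos i hiτ).ne', zero_mul]

/-- `T` has a facet that supports the whole configuration. -/
def HasBoundaryFacet (p : ι → EuclideanSpace ℝ (Fin d)) (T : Finset (Finset ι)) : Prop :=
  ∃ σ ∈ T, ∃ v ∈ σ, ∃ g : EuclideanSpace ℝ (Fin d) →ᵃ[ℝ] ℝ,
    (∀ i ∈ σ.erase v, g (p i) = 0) ∧ (∀ i, i ∉ σ.erase v → 0 < g (p i)) ∧
      ∀ ρ ∈ T, σ.erase v ⊆ ρ → ρ = σ

/-- Matching alone would allow multiple coverings. If two cells overlapped, the set doubly covered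
by overlapping pairs would spread over the whole hull, and so would contain the barycentre of the
boundary facet, which lies in a single cell. -/
theorem IsMatched.not_overlap (hm : IsMatched p T) (gp : GeneralPosition p)
    (hT : ∀ σ ∈ T, IsFullCell p σ) (hd : 0 < d) (hb : HasBoundaryFacet p T)
    (hσ : σ ∈ T) (hσ' : σ' ∈ T) : ¬ Overlap p σ σ' := by
  classical
  intro ho
  let W : Set (EuclideanSpace ℝ (Fin d)) :=
    ⋃ k ∈ (T ×ˢ T).filter fun k => Overlap p k.1 k.2,
      convexHull ℝ (points p k.1) ∩ convexHull ℝ (points p k.2)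
  have hW : ∀ ρ ∈ T, ∀ ρ' ∈ T, Overlap p ρ ρ' →
      convexHull ℝ (points p ρ) ∩ convexHull ℝ (points p ρ') ⊆ W := by
    intro ρ hρ ρ' hρ' h y hy
    exact mem_iUnion₂.2 ⟨(ρ, ρ'), by simp [hρ, hρ', h], hy⟩
  have hclosed : IsClosed W :=
    (Finset.finite_toSet _).isClosed_biUnion fun k _ =>
      (isClosed_convexHull_points k.1).inter (isClosed_convexHull_points k.2)
  have hint := interior_nonempty_of_mem hT hσ
  have hsub : interior (convexHull ℝ (range p)) ⊆ W := by
    refine subset_of_forall_onAtMostOneFacet gp hT isOpen_interior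
      (convex_convexHull ℝ _).interior hclosed ?_ ?_
    · intro z hz hzi hgen
      obtain ⟨⟨ρ, ρ'⟩, hk, hzρ, hzρ'⟩ := mem_iUnion₂.1 hz
      simp only [Finset.mem_filter, Finset.mem_product] at hk hzρ hzρ'
      obtain ⟨⟨hρ, hρ'⟩, ho⟩ := hk
      by_cases h1 : z ∈ interior (convexHull ℝ (points p ρ))
      · exact hm.nhds_of_mem_interior hT hρ' h1 hzρ' hzi hgen (hT ρ hρ) ho fun r hr hor =>
          hW ρ hρ r hr hor
      by_cases h2 : z ∈ interior (convexHull ℝ (points p ρ'))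
      · exact hm.nhds_of_mem_interior hT hρ h2 hzρ hzi hgen (hT ρ' hρ') ho.symm
          fun r hr hor => hW ρ' hρ' r hr hor
      -- Here `z` is on the boundary of both cells, so by genericity on the same facet of both. Then
      -- `ρ'` is `ρ` or its neighbour across that facet, and neither overlaps `ρ`.
      exfalso
      obtain ⟨v, hv, h0⟩ := exists_bary_eq_zero (hT ρ hρ) hzρ h1
      obtain ⟨v', hv', h0'⟩ := exists_bary_eq_zero (hT ρ' hρ') hzρ' h2
      obtain ⟨r, hr, w, hop, huniq⟩ := hm.exists_opposite hT hρ hv h0 hzi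
      have he := hgen ρ hρ v hv ρ' hρ' v' hv' h0 h0'
      rcases huniq ρ' hρ' (he ▸ Finset.erase_subset v' ρ') with rfl | rfl
      · exact ho.1 rfl
      · exact ho.2.not_disjoint hop.disjoint
    · obtain ⟨y, hy, hy'⟩ := ho.2
      refine ⟨y, interior_mono (convexHull_points_subset σ) hy, ?_⟩
      exact interior_mono (hW σ hσ σ' hσ' ho) (by rw [interior_inter]; exact ⟨hy, hy'⟩)
  have h1 := closure_minimal hsub hclosed
  rw [(convex_convexHull ℝ _).closure_interior_eq_closure_of_nonempty_interior
    (hint.mono inter_subset_left)] at h1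
  obtain ⟨s, hs, v, hv, g, hg0, hgpos, huniq⟩ := hb
  obtain ⟨z, hz, hzs⟩ := exists_forall_mem_subset hd hT hs hv hg0 hgpos
  obtain ⟨⟨ρ, ρ'⟩, hk, hzρ, hzρ'⟩ := mem_iUnion₂.1 (h1 (subset_closure hz))
  simp only [Finset.mem_filter, Finset.mem_product] at hk hzρ hzρ'
  exact hk.2.1 ((huniq ρ hk.1.1 (hzs ρ hk.1.1 hzρ)).trans
    (huniq ρ' hk.1.2 (hzs ρ' hk.1.2 hzρ')).symm)

/-- Let `τ` be the minimal face of `σ` containing `x`. Walking near `x` never crosses a facet that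
omits a vertex of `τ`, so the cells containing `τ` cover the interior of the hull near `x`. Since
`σ'` has interior points there, it overlaps or equals one of these cells, hence equals it. -/
theorem IsMatched.mem_of_bary_pos (hm : IsMatched p T) (gp : GeneralPosition p)
    (hT : ∀ σ ∈ T, IsFullCell p σ) (hdis : ∀ σ ∈ T, ∀ σ' ∈ T, ¬ Overlap p σ σ')
    (hσ : σ ∈ T) (hσ' : σ' ∈ T) {x : EuclideanSpace ℝ (Fin d)}
    (hx : x ∈ convexHull ℝ (points p σ)) (hx' : x ∈ convexHull ℝ (points p σ')) :
    ∀ v ∈ σ, 0 < bary p σ v x → v ∈ σ' := by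
  set τ := σ.filter fun v => 0 < bary p σ v x with hτ
  have hxτ : ∀ ρ ∈ T, τ ⊆ ρ → ∀ v ∈ τ, 0 < bary p ρ v x := by
    intro ρ hρ hs v hv
    have hvσ := Finset.mem_filter.1 hv
    rw [affine_eq_sum_bary (hT σ hσ), Finset.sum_eq_single v, bary_self (hT ρ hρ) (hs hv), mul_one]
    · exact hvσ.2
    · intro i hi hiv
      by_cases hiτ : i ∈ τ
      · rw [bary_ne (hT ρ hρ) (hs hv) (hs hiτ) hiv.symm, mul_zero]
      · have h1 : ¬ 0 < bary p σ i x := fun h => hiτ (Finset.mem_filter.2 ⟨hi, h⟩)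
        have h2 := (mem_convexHull_points (hT σ hσ)).1 hx i hi
        rw [le_antisymm (not_lt.1 h1) h2, zero_mul]
    · exact fun h => absurd hvσ.1 h
  -- A convex open neighbourhood of `x` that avoids every facet hyperplane opposite to a vertex of
  -- `τ` in a cell containing `τ`.
  let U : Set (EuclideanSpace ℝ (Fin d)) :=
    ⋂ ρ ∈ T.filter (τ ⊆ ·), ⋂ v ∈ τ, {y | 0 < bary p ρ v y}
  have hmemU : ∀ y, y ∈ U ↔ ∀ ρ ∈ T, τ ⊆ ρ → ∀ v ∈ τ, 0 < bary p ρ v y := by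
    intro y
    simp only [U, mem_iInter, Finset.mem_filter, and_imp, mem_ofPred_eq]
  have hUo : IsOpen U := by
    refine isOpen_biInter_finset fun ρ _ => isOpen_biInter_finset fun v _ => ?_
    exact isOpen_lt continuous_const (continuous_bary v)
  have hUc : Convex ℝ U := by
    refine convex_iInter₂ fun ρ _ => convex_iInter₂ fun v _ => ?_
    exact (convex_Ioi (0 : ℝ)).affine_preimage (bary p ρ v)
  have hxU : x ∈ U := (hmemU x).2 hxτ
  let W : Set (EuclideanSpace ℝ (Fin d)) := ⋃ ρ ∈ T.filter (τ ⊆ ·), convexHull ℝ (points p ρ)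
  have hW : ∀ ρ ∈ T, τ ⊆ ρ → convexHull ℝ (points p ρ) ⊆ W := fun ρ hρ hs y hy =>
    mem_iUnion₂.2 ⟨ρ, Finset.mem_filter.2 ⟨hρ, hs⟩, hy⟩
  have hclosed : IsClosed W :=
    (Finset.finite_toSet _).isClosed_biUnion fun σ _ => isClosed_convexHull_points σ
  have hmeet : ∀ ρ ∈ T, x ∈ convexHull ℝ (points p ρ) →
      ∃ y ∈ U, y ∈ interior (convexHull ℝ (points p ρ)) := fun ρ hρ hxρ =>
    mem_closure_iff.1 (convexHull_points_subset_closure (hT ρ hρ) hxρ) U hUo hxU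
  have hsub : interior (convexHull ℝ (range p)) ∩ U ⊆ W := by
    refine subset_of_forall_onAtMostOneFacet gp hT (isOpen_interior.inter hUo)
      ((convex_convexHull ℝ _).interior.inter hUc) hclosed ?_ ?_
    · rintro z hz ⟨hzi, hzU⟩ hgen
      obtain ⟨ρ, hρ, hzρ⟩ := mem_iUnion₂.1 hz
      obtain ⟨hρ, hs⟩ := Finset.mem_filter.1 hρ
      refine hm.nhds_of_mem hT hρ hzρ hzi hgen fun r hr hc => hW r hr ?_
      rcases hc with rfl | ⟨v, hv, h0, hvr⟩
      · exact hs
      · refine fun i hi => hvr (Finset.mem_erase.2 ⟨?_, hs hi⟩)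
        rintro rfl
        exact ((hmemU z).1 hzU ρ hρ hs i hi).ne' h0
    · obtain ⟨y, hyU, hy⟩ := hmeet σ hσ hx
      exact ⟨y, ⟨interior_mono (convexHull_points_subset σ) hy, hyU⟩,
        interior_mono (hW σ hσ (Finset.filter_subset _ _)) hy⟩
  obtain ⟨y, hyU, hy⟩ := hmeet σ' hσ' hx'
  obtain ⟨ρ, hρ, hyρ⟩ := mem_iUnion₂.1 (hsub ⟨interior_mono (convexHull_points_subset σ') hy, hyU⟩)
  obtain ⟨hρ, hs⟩ := Finset.mem_filter.1 hρ
  have hne := mem_closure_iff.1 (convexHull_points_subset_closure (hT ρ hρ) hyρ) _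
    isOpen_interior hy
  have : σ' = ρ := by
    by_contra hne'
    exact hdis σ' hσ' ρ hρ ⟨hne', hne⟩
  intro v hv hvx
  rw [this]
  exact hs (Finset.mem_filter.2 ⟨hv, hvx⟩)

/-- If all vertices of `σ` with positive coordinates at a common point with `σ'` are in `σ'`,
then the intersection with `σ'` is a face of `σ`. -/
theorem isExposed_inter (hσ : IsFullCell p σ)
    (h : ∀ x ∈ convexHull ℝ (points p σ), x ∈ convexHull ℝ (points p σ') →
      ∀ v ∈ σ, 0 < bary p σ v x → v ∈ σ') :
    IsExposed ℝ (convexHull ℝ (points p σ))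
      (convexHull ℝ (points p σ) ∩ convexHull ℝ (points p σ')) := by
  rintro ⟨x0, hx0, hx0'⟩
  -- This sum is nonnegative on the cell and vanishes there exactly on the face spanned by `σ ∩ σ'`;
  -- its negated linear part exposes that face.
  let f : EuclideanSpace ℝ (Fin d) →ᵃ[ℝ] ℝ := ∑ v ∈ σ \ σ', bary p σ v
  have hf : ∀ x, f x = ∑ v ∈ σ \ σ', bary p σ v x := fun x => by
    simp only [f]
    induction σ \ σ' using Finset.induction_on with
    | empty => simp
    | insert a s ha ih => rw [Finset.sum_insert ha, Finset.sum_insert ha, ← ih]; rfl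
  have hnn : ∀ x ∈ convexHull ℝ (points p σ), ∀ v ∈ σ \ σ', 0 ≤ bary p σ v x := fun x hx v hv =>
    (mem_convexHull_points hσ).1 hx v (Finset.mem_sdiff.1 hv).1
  have hzero : ∀ x ∈ convexHull ℝ (points p σ), x ∈ convexHull ℝ (points p σ') → f x = 0 := by
    intro x hx hx'
    rw [hf, Finset.sum_eq_zero]
    intro v hv
    refine le_antisymm (not_lt.1 fun hlt => ?_) (hnn x hx v hv)
    exact (Finset.mem_sdiff.1 hv).2 (h x hx hx' v (Finset.mem_sdiff.1 hv).1 hlt)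
  have hlin : ∀ x y, f.linear y - f.linear x = f y - f x := fun x y => by
    rw [← map_sub]
    simpa using f.linearMap_vsub y x
  refine ⟨-(LinearMap.toContinuousLinearMap f.linear), ?_⟩
  ext x
  constructor
  · rintro ⟨hx, hx'⟩
    refine ⟨hx, fun y hy => ?_⟩
    have h1 := hlin x y
    rw [hzero x hx hx'] at h1
    have h2 : 0 ≤ f y := by
      rw [hf]
      exact Finset.sum_nonneg (hnn y hy)
    simp only [neg_apply, LinearMap.coe_toContinuousLinearMap']
    linarith
  · rintro ⟨hx, hmin⟩
    refine ⟨hx, ?_⟩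
    have h1 := hmin x0 hx0
    have h2 := hlin x x0
    rw [hzero x0 hx0 hx0'] at h2
    simp only [neg_apply, LinearMap.coe_toContinuousLinearMap'] at h1
    have h3 : f x = 0 := by
      refine le_antisymm (by linarith) ?_
      rw [hf]
      exact Finset.sum_nonneg (hnn x hx)
    rw [hf, Finset.sum_eq_zero_iff_of_nonneg (hnn x hx)] at h3
    have hsum : ∑ i ∈ σ ∩ σ', bary p σ i x • p i = x := by
      conv_rhs => rw [← sum_bary_smul hσ x, ← Finset.sum_inter_add_sum_sdiff σ σ']
      rw [Finset.sum_eq_zero (s := σ \ σ') fun i hi => by rw [h3 i hi, zero_smul], add_zero]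
    have hone : ∑ i ∈ σ ∩ σ', bary p σ i x = 1 := by
      conv_rhs => rw [← sum_bary hσ x, ← Finset.sum_inter_add_sum_sdiff σ σ']
      rw [Finset.sum_eq_zero (s := σ \ σ') h3, add_zero]
    rw [← hsum]
    refine (convex_convexHull ℝ _).sum_mem
      (fun i hi => (mem_convexHull_points hσ).1 hx i (Finset.mem_inter.1 hi).1) hone
      fun i hi => subset_convexHull ℝ _ (mem_image_of_mem p (Finset.mem_inter.1 hi).2)

/-- A family of full cells of a configuration in general position is a triangulation if it is
matched along its facets and some facet supports the configuration. -/
theorem IsMatched.isTriangulation [Finite ι] (hm : IsMatched p T) (gp : GeneralPosition p)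
    (hT : ∀ σ ∈ T, IsFullCell p σ) (hd : 0 < d) (hb : HasBoundaryFacet p T) :
    IsTriangulation p T where
  independent σ hσ := (hT σ hσ).1
  spanning σ hσ := by
    rw [(hT σ hσ).affineSpan_points, eq_comm, eq_top_iff, ← (hT σ hσ).affineSpan_points]
    exact affineSpan_mono ℝ (image_subset_range _ _)
  face σ hσ σ' hσ' := by
    have hdis : ∀ σ ∈ T, ∀ σ' ∈ T, ¬ Overlap p σ σ' := fun σ hσ σ' hσ' =>
      hm.not_overlap gp hT hd hb hσ hσ'
    refine ⟨isExposed_inter (hT σ hσ) fun x hx hx' =>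
      hm.mem_of_bary_pos gp hT hdis hσ hσ' hx hx', ?_⟩
    rw [inter_comm]
    exact isExposed_inter (hT σ' hσ') fun x hx hx' =>
      hm.mem_of_bary_pos gp hT hdis hσ' hσ hx hx'
  cover := by
    obtain ⟨σ, hσ, -⟩ := hb
    exact hm.cover gp hT ⟨σ, hσ⟩

end Criterion

/-! ### Cells that survive all flips -/

section Flips

variable {d : ℕ} {ι : Type*} {p : ι → EuclideanSpace ℝ (Fin d)}
  {T R : Finset (Finset ι)} {σ σ' : Finset ι}

theorem Independent.mono (h : Independent p σ') (hs : σ ⊆ σ') : Independent p σ :=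
  AffineIndependent.comp_embedding (f := ⟨fun i : σ => (⟨i, hs i.2⟩ : σ'),
    fun i j hij => Subtype.ext (by simpa using hij)⟩) h

theorem GeneralPosition.independent [Fintype ι] (gp : GeneralPosition p)
    (hcard : d + 1 ≤ Fintype.card ι) (h : σ.card ≤ d + 1) : Independent p σ := by
  obtain ⟨ρ, hρ, hc⟩ := Finset.exists_superset_card_eq h hcard
  exact (gp ρ hc).mono hρ

theorem IsTriangulation.isFullCell [Fintype ι] (h : IsTriangulation p T)
    (gp : GeneralPosition p) (hcard : d + 1 ≤ Fintype.card ι) (hσ : σ ∈ T) : IsFullCell p σ := by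
  obtain ⟨ρ, -, hc⟩ := Finset.exists_superset_card_eq
    (s := (∅ : Finset ι)) (n := d + 1) (by simp) hcard
  have hρ : IsFullCell p ρ := ⟨gp ρ hc, hc⟩
  have htop : affineSpan ℝ (points p σ) = ⊤ := by
    rw [h.spanning σ hσ, eq_top_iff, ← hρ.affineSpan_points]
    exact affineSpan_mono ℝ (image_subset_range _ _)
  refine ⟨h.independent σ hσ, ?_⟩
  have h1 : affineSpan ℝ (range fun i : σ => p i) = ⊤ := by
    rw [← htop, points, image_eq_range]
    rfl
  rw [AffineIndependent.affineSpan_eq_top_iff_card_eq_finrank_add_one (h.independent σ hσ)] at h1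
  simpa using h1

/-- A face of a set that contains an interior point is everything. -/
theorem subset_of_isExposed {A B : Set (EuclideanSpace ℝ (Fin d))} (h : IsExposed ℝ A B)
    {x : EuclideanSpace ℝ (Fin d)} (hx : x ∈ interior A) (hxB : x ∈ B) : A ⊆ B := by
  intro y hy
  have hc : Continuous fun t : ℝ => AffineMap.lineMap x y t := AffineMap.lineMap_continuous
  have hev : ∀ᶠ t in 𝓝[<] (0 : ℝ), AffineMap.lineMap x y t ∈ A := by
    have h1 : Tendsto (fun t : ℝ => AffineMap.lineMap x y t) (𝓝[<] 0) (𝓝 x) := by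
      have h2 := hc.tendsto 0
      rw [AffineMap.lineMap_apply_zero] at h2
      exact h2.mono_left nhdsWithin_le_nhds
    exact h1.eventually (mem_interior_iff_mem_nhds.1 hx)
  obtain ⟨t, htA, ht⟩ := (hev.and self_mem_nhdsWithin).exists
  have ht : t < 0 := ht
  obtain ⟨l, rfl⟩ := h ⟨x, hxB⟩
  have hlt : l (AffineMap.lineMap x y t) = l x + t * (l y - l x) := by
    simp [AffineMap.lineMap_apply]
    ring
  have h1 := hxB.2 _ htA
  have h2 := hxB.2 y hy
  have h3 : l x ≤ l y := by
    rw [hlt] at h1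
    nlinarith
  exact ⟨hy, fun z hz => (hxB.2 z hz).trans h3⟩

variable [DecidableEq ι]

/-- A common face containing an interior point is the whole simplex, so both hulls coincide. A
vertex of `σ'` not in `σ` would then, by general position, be interior to `σ` and so to `σ'`, of
which it is a vertex. -/
theorem IsTriangulation.not_overlap (h : IsTriangulation p T) (gp : GeneralPosition p)
    (hd : 0 < d) (hT : ∀ σ ∈ T, IsFullCell p σ) (hσ : σ ∈ T) (hσ' : σ' ∈ T) :
    ¬ Overlap p σ σ' := by
  rintro ⟨hne, x, hx, hx'⟩
  have hmem := And.intro (interior_subset hx) (interior_subset hx')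
  have h1 := (subset_of_isExposed (h.face σ hσ σ' hσ').1 hx hmem).trans inter_subset_right
  have h2 := (subset_of_isExposed (h.face σ hσ σ' hσ').2 hx' hmem).trans inter_subset_left
  have hns : ¬ σ' ⊆ σ := fun hs => hne (Finset.eq_of_subset_of_card_le hs
    (by rw [(hT σ hσ).2, (hT σ' hσ').2])).symm
  obtain ⟨w, hw, hwσ⟩ := Finset.not_subset.1 hns
  have hpw : p w ∈ convexHull ℝ (points p σ) :=
    h2 (subset_convexHull ℝ _ (mem_image_of_mem p hw))
  have hpi : p w ∈ interior (convexHull ℝ (points p σ')) := by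
    refine interior_mono h1 ((mem_interior_convexHull_points (hT σ hσ)).2 fun i hi => ?_)
    exact ((mem_convexHull_points (hT σ hσ)).1 hpw i hi).lt_of_ne
      (bary_ne_zero gp (hT σ hσ) hi fun h => hwσ (Finset.mem_of_mem_erase h)).symm
  obtain ⟨i, hi, hiw⟩ : ∃ i ∈ σ', i ≠ w :=
    Finset.exists_mem_ne (by rw [(hT σ' hσ').2]; omega) w
  have h3 := (mem_interior_convexHull_points (hT σ' hσ')).1 hpi i hi
  rw [bary_ne (hT σ' hσ') hi hw hiw] at h3
  exact lt_irrefl _ h3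

theorem exists_mem_facet (hd : 0 < d) (hσ : IsFullCell p σ) {v : ι} (hv : v ∈ σ) :
    ∃ z, bary p σ v z = 0 ∧ ∀ i ∈ σ.erase v, 0 < bary p σ i z := by
  have hd' : (0 : ℝ) < d := Nat.cast_pos.2 hd
  have hw : ∑ i ∈ σ.erase v, (1 / d : ℝ) = 1 := by
    rw [Finset.sum_const, Finset.card_erase_of_mem hv, hσ.2]
    simp [hd'.ne']
  refine ⟨∑ i ∈ σ.erase v, (1 / d : ℝ) • p i, ?_, fun k hk => ?_⟩
  · rw [affine_sum_smul hw]
    refine Finset.sum_eq_zero fun i hi => ?_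
    rw [bary_ne hσ hv (Finset.mem_of_mem_erase hi) (Finset.ne_of_mem_erase hi).symm, mul_zero]
  · have hkσ := Finset.mem_of_mem_erase hk
    rw [affine_sum_smul hw, Finset.sum_eq_single k, bary_self hσ hkσ]
    · simpa using hd
    · intro i hi hik
      rw [bary_ne hσ hkσ (Finset.mem_of_mem_erase hi) hik.symm, mul_zero]
    · exact fun h => absurd hk h

/-- Two cells of a triangulation on the same side of a common facet are equal. -/
theorem IsTriangulation.eq_of_same_side (h : IsTriangulation p T) (gp : GeneralPosition p)
    (hd : 0 < d) (hT : ∀ σ ∈ T, IsFullCell p σ) (hσ : σ ∈ T) (hσ' : σ' ∈ T) {v w : ι}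
    (hv : v ∈ σ) (hw : w ∈ σ') (he : σ'.erase w = σ.erase v) (hpos : 0 < bary p σ v (p w)) :
    σ = σ' := by
  have key : ∀ x, bary p σ v x = bary p σ' w x * bary p σ v (p w) :=
    affine_eq_bary_mul (hT σ' hσ') hw fun i hi => by
      rw [he] at hi
      exact bary_ne (hT σ hσ) hv (Finset.mem_of_mem_erase hi) (Finset.ne_of_mem_erase hi).symm
  obtain ⟨z, hz, hzpos⟩ := exists_mem_facet hd (hT σ hσ) hv
  have hz' : ∀ i ∈ σ'.erase w, 0 < bary p σ' i z := by
    intro i hi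
    rw [bary_eq_of_bary_eq_zero (hT σ hσ) (hT σ' hσ') hv (he ▸ Finset.erase_subset w σ') hz
      (Finset.mem_of_mem_erase hi), if_pos (he ▸ hi)]
    exact hzpos i (he ▸ hi)
  have hc : Continuous fun t : ℝ => AffineMap.lineMap z (p v) t := AffineMap.lineMap_continuous
  have ht : Tendsto (fun t : ℝ => AffineMap.lineMap z (p v) t) (𝓝[>] 0) (𝓝 z) := by
    have h2 := hc.tendsto 0
    rw [AffineMap.lineMap_apply_zero] at h2
    exact h2.mono_left nhdsWithin_le_nhds
  have h1 : ∀ᶠ y in 𝓝 z, ∀ i ∈ σ.erase v, 0 < bary p σ i y :=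
    (Finset.eventually_all _).2 fun i hi =>
      (continuous_bary i).continuousAt.eventually (lt_mem_nhds (hzpos i hi))
  have h2 : ∀ᶠ y in 𝓝 z, ∀ i ∈ σ'.erase w, 0 < bary p σ' i y :=
    (Finset.eventually_all _).2 fun i hi =>
      (continuous_bary i).continuousAt.eventually (lt_mem_nhds (hz' i hi))
  obtain ⟨t, ⟨ht1, ht2⟩, ht0⟩ :=
    (((ht.eventually h1).and (ht.eventually h2)).and self_mem_nhdsWithin).exists
  have hvt : 0 < bary p σ v (AffineMap.lineMap z (p v) t) := by
    rw [AffineMap.apply_lineMap, AffineMap.lineMap_apply, hz, bary_self (hT σ hσ) hv]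
    simpa using ht0
  -- The point just off the common facet, towards `p v`, is interior to both cells.
  by_contra hne
  refine h.not_overlap gp hd hT hσ hσ' ⟨hne, AffineMap.lineMap z (p v) t, ?_, ?_⟩
  · refine (mem_interior_convexHull_points (hT σ hσ)).2 fun i hi => ?_
    by_cases hiv : i = v
    · rwa [hiv]
    · exact ht1 i (Finset.mem_erase.2 ⟨hiv, hi⟩)
  · refine (mem_interior_convexHull_points (hT σ' hσ')).2 fun i hi => ?_
    by_cases hiw : i = w
    · rw [hiw]
      rw [key] at hvt
      exact pos_of_mul_pos_left hvt hpos.le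
    · exact ht2 i (Finset.mem_erase.2 ⟨hiw, hi⟩)

theorem IsSignedCircuit.symm {P N : Finset ι} (h : IsSignedCircuit p P N) :
    IsSignedCircuit p N P := by
  obtain ⟨hC, w, hP, hN, h0, h1⟩ := h
  rw [Finset.union_comm] at hC h0 h1
  refine ⟨hC, fun i => -w i, fun i hi => neg_pos.2 (hN i hi), fun i hi => neg_neg_of_pos (hP i hi),
    ?_, ?_⟩
  · rw [Finset.sum_neg_distrib, h0, neg_zero]
  · simp only [neg_smul, Finset.sum_neg_distrib, h1, neg_zero]

theorem IsSignedCircuit.nonempty {P N : Finset ι} (h : IsSignedCircuit p P N) : P.Nonempty := by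
  obtain ⟨hC, w, hP, hN, h0, -⟩ := h
  by_contra hP0
  obtain rfl := Finset.not_nonempty_iff_eq_empty.1 hP0
  rw [Finset.empty_union] at h0 hC
  rcases N.eq_empty_or_nonempty with rfl | hne
  · refine hC.1 ?_
    have : Subsingleton (∅ : Finset ι) := ⟨fun a => absurd a.2 (Finset.notMem_empty _)⟩
    exact affineIndependent_of_subsingleton ℝ _
  · exact (Finset.sum_neg hN hne).ne h0

/-- Every point off a cell of `R` is separated from this cell by one of its facets, and the cell
of `R` on the other side of this facet does not have this point as a vertex. -/
def IsLocked (p : ι → EuclideanSpace ℝ (Fin d)) (R : Finset (Finset ι)) : Prop :=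
  ∀ σ ∈ R, ∀ c, c ∉ σ → ∃ v ∈ σ, bary p σ v (p c) < 0 ∧
    ∃ σ' ∈ R, σ' ≠ σ ∧ σ.erase v ⊆ σ' ∧ c ∉ σ'

/-- Both `σ'` and `ρ` must lie on the side of the facet away from `σ`, hence on the same side as
each other, so `IsTriangulation.eq_of_same_side` identifies them. -/
theorem IsTriangulation.eq_of_opposite (h : IsTriangulation p T) (gp : GeneralPosition p)
    (hd : 0 < d) (hT : ∀ σ ∈ T, IsFullCell p σ) (hσ : σ ∈ T) (hσ' : σ' ∈ T) {ρ : Finset ι}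
    (hρ : ρ ∈ T) {v : ι} (hv : v ∈ σ) (hs' : σ.erase v ⊆ σ') (hs : σ.erase v ⊆ ρ)
    (hne' : σ' ≠ σ) (hne : ρ ≠ σ) : σ' = ρ := by
  have hc : (σ.erase v).card = d := by rw [Finset.card_erase_of_mem hv, (hT σ hσ).2]; simp
  have key : ∀ r ∈ T, σ.erase v ⊆ r → r ≠ σ →
      ∃ w ∈ r, r.erase w = σ.erase v ∧ bary p σ v (p w) < 0 := by
    intro r hr hsr hrne
    have h1 : (r \ σ.erase v).card = 1 := by
      rw [Finset.card_sdiff_of_subset hsr, (hT r hr).2, hc]; simp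
    obtain ⟨w, hw⟩ := Finset.card_eq_one.1 h1
    obtain ⟨hwr, hwσ⟩ : w ∈ r ∧ w ∉ σ.erase v :=
      Finset.mem_sdiff.1 (hw ▸ Finset.mem_singleton_self w)
    have he : r.erase w = σ.erase v := by
      refine (Finset.eq_of_subset_of_card_le (fun i hi => Finset.mem_erase.2 ⟨?_, hsr hi⟩) ?_).symm
      · rintro rfl
        exact hwσ hi
      · rw [Finset.card_erase_of_mem hwr, (hT r hr).2, hc]; simp
    refine ⟨w, hwr, he, (bary_ne_zero gp (hT σ hσ) hv hwσ).lt_or_gt.resolve_right fun hpos => ?_⟩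
    exact hrne (h.eq_of_same_side gp hd hT hσ hr hv hwr he hpos).symm
  obtain ⟨w', hw', he', hneg'⟩ := key σ' hσ' hs' hne'
  obtain ⟨w, hw, he, hneg⟩ := key ρ hρ hs hne
  refine h.eq_of_same_side gp hd hT hσ' hρ hw' hw (he.trans he'.symm) ?_
  have h1 := affine_eq_bary_mul (g := bary p σ v) (hT σ' hσ') hw' (fun i hi => by
    rw [he'] at hi
    exact bary_ne (hT σ hσ) hv (Finset.mem_of_mem_erase hi) (Finset.ne_of_mem_erase hi).symm) (p w)
  rw [h1] at hneg
  by_contra h2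
  nlinarith [mul_nonneg_of_nonpos_of_nonpos (not_lt.1 h2) hneg'.le]

/-- No cell of a locked part of a triangulation is in a flippable circuit. -/
theorem IsLocked.notMem (hR : IsLocked p R) (hRT : R ⊆ T) (h : IsTriangulation p T)
    (gp : GeneralPosition p) (hd : 0 < d) (hT : ∀ σ ∈ T, IsFullCell p σ) {P N : Finset ι}
    (hC : IsSignedCircuit p P N) (hP : ∀ c ∈ P, (P ∪ N).erase c ∈ T) {c : ι} (hc : c ∈ P) :
    (P ∪ N).erase c ∉ R := by
  intro hD
  obtain ⟨v, hv, hneg, ρ, hρ, hne, hs, hcρ⟩ := hR _ hD c (Finset.notMem_erase c _)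
  obtain ⟨-, w, hwP, hwN, h0, h1⟩ := hC
  have hcC : c ∈ P ∪ N := Finset.mem_union_left N hc
  have hvC := Finset.mem_of_mem_erase hv
  have hD' := hT _ (hRT hD)
  set g := bary p ((P ∪ N).erase c) v with hg
  -- Affine functions respect the dependence. As `g` vanishes at all vertices of the cell except
  -- `v`, only the terms of `c` and `v` survive: `w c * g (p c) + w v = 0` with `g (p c) < 0`.
  have hsum : ∑ i ∈ P ∪ N, w i * g (p i) = 0 := by
    have key : ∀ y, g y = g.linear y + g 0 := fun y => by
      simpa using congrFun g.decomp y
    have h2 : g.linear (∑ i ∈ P ∪ N, w i • p i) = 0 := by rw [h1, map_zero]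
    rw [map_sum] at h2
    calc ∑ i ∈ P ∪ N, w i * g (p i)
        = ∑ i ∈ P ∪ N, g.linear (w i • p i) + (∑ i ∈ P ∪ N, w i) * g 0 := by
          rw [Finset.sum_mul, ← Finset.sum_add_distrib]
          refine Finset.sum_congr rfl fun i _ => ?_
          rw [key (p i), map_smul, smul_eq_mul]
          ring
      _ = 0 := by rw [h2, h0]; ring
  rw [← Finset.add_sum_erase _ _ hcC, Finset.sum_eq_single v, bary_self hD' hv, mul_one] at hsum
  · have hwv : 0 < w v := by nlinarith [hwP c hc]
    have hvP : v ∈ P := by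
      rcases Finset.mem_union.1 hvC with h | h
      · exact h
      · exact absurd hwv (hwN v h).not_gt
    have hvc : v ≠ c := Finset.ne_of_mem_erase hv
    have hcv : c ∈ (P ∪ N).erase v := Finset.mem_erase.2 ⟨hvc.symm, hcC⟩
    -- Both `ρ` and `C \ {v}` are cells of `T` across the facet `C \ {c, v}`, but only the second
    -- contains `c`.
    have := h.eq_of_opposite gp hd hT (hRT hD) (hRT hρ) (hP v hvP) hv hs
      (fun i hi => Finset.mem_erase.2 ⟨Finset.ne_of_mem_erase hi,
        Finset.mem_of_mem_erase (Finset.mem_of_mem_erase hi)⟩) hne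
      (fun h => Finset.notMem_erase c (P ∪ N) (h ▸ hcv))
    exact hcρ (this ▸ hcv)
  · intro i hi hiv
    rw [hg, bary_ne hD' hv hi hiv.symm, mul_zero]
  · exact fun h => absurd hv h

variable [Fintype ι]

/-- In general position, a flip exchanges the two triangulations of a full-dimensional circuit. -/
theorem IsFlip.exists_circuit {T' : Finset (Finset ι)} (hf : IsFlip p T T')
    (gp : GeneralPosition p) (hcard : d + 1 ≤ Fintype.card ι) (hT : ∀ σ ∈ T, IsFullCell p σ) :
    ∃ P N : Finset ι, IsSignedCircuit p P N ∧ (∀ c ∈ P, (P ∪ N).erase c ∈ T) ∧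
      T' = (T \ deletions (P ∪ N) P) ∪ deletions (P ∪ N) N := by
  obtain ⟨P, N, hC, L, hL, hlink, rfl⟩ := hf
  have hCc : d + 2 ≤ (P ∪ N).card := by
    by_contra hlt
    exact hC.1.1 (gp.independent hcard (by omega))
  have hdel : ∀ c ∈ P, link T ((P ∪ N).erase c) = L := fun c hc =>
    hlink _ (Finset.mem_image_of_mem _ hc)
  -- The deletions of the circuit already have at least `d + 1` elements, so nothing can be joined
  -- to them within a full cell.
  have hρ : ∀ c ∈ P, ∀ ρ ∈ L, ρ = ∅ := by
    intro c hc ρ hρ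
    rw [← hdel c hc, link, Finset.mem_filter] at hρ
    have h1 := (hT _ hρ.2.2).2
    rw [Finset.card_union_of_disjoint hρ.2.1,
      Finset.card_erase_of_mem (Finset.mem_union_left N hc)] at h1
    exact Finset.card_eq_zero.1 (by omega)
  obtain ⟨c₀, hc₀⟩ := hC.nonempty
  have hL0 : L = {∅} := by
    obtain ⟨ρ, hρL⟩ := hL
    refine Finset.eq_singleton_iff_unique_mem.2 ⟨hρ c₀ hc₀ ρ hρL ▸ hρL, hρ c₀ hc₀⟩
  refine ⟨P, N, hC, fun c hc => ?_, ?_⟩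
  · have h1 : ∅ ∈ link T ((P ∪ N).erase c) := by rw [hdel c hc, hL0]; simp
    rw [link, Finset.mem_filter, Finset.empty_union] at h1
    exact h1.2.2
  · rw [hL0, Finset.image₂_singleton_left, Finset.image₂_singleton_left]
    simp

/-- A locked part of a triangulation is kept by all flips. -/
theorem IsLocked.subset_of_reachable (hR : IsLocked p R) (gp : GeneralPosition p)
    (hcard : d + 1 ≤ Fintype.card ι) (hd : 0 < d)
    {T₁ T₂ : {T : Finset (Finset ι) // IsTriangulation p T}} (h : (flipGraph p).Reachable T₁ T₂)
    (h₁ : R ⊆ T₁.1) : R ⊆ T₂.1 := by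
  obtain ⟨walk⟩ := h
  induction walk with
  | nil => exact h₁
  | @cons S S' _ hadj _ ih =>
    have hS : ∀ σ ∈ S.1, IsFullCell p σ := fun σ hσ => S.2.isFullCell gp hcard hσ
    have hS' : ∀ σ ∈ S'.1, IsFullCell p σ := fun σ hσ => S'.2.isFullCell gp hcard hσ
    refine ih fun D hD => ?_
    rw [flipGraph, SimpleGraph.fromRel_adj] at hadj
    rcases hadj.2 with hf | hf
    · obtain ⟨P, N, hC, hP, he⟩ := hf.exists_circuit gp hcard hS
      rw [he]
      refine Finset.mem_union_left _ (Finset.mem_sdiff.2 ⟨h₁ hD, fun hdel => ?_⟩)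
      obtain ⟨c, hc, rfl⟩ := Finset.mem_image.1 hdel
      exact hR.notMem h₁ S.2 gp hd hS hC hP hc hD
    -- Edges are undirected: for a flip from `S'` to `S`, the reversed circuit has all its deletions
    -- in `S`, so lockedness applies to `S` again.
    · obtain ⟨P, N, hC, -, he⟩ := hf.exists_circuit gp hcard hS'
      have hN : ∀ c ∈ N, (N ∪ P).erase c ∈ S.1 := fun c hc => by
        rw [he, Finset.union_comm N P]
        exact Finset.mem_union_right _ (Finset.mem_image_of_mem _ hc)
      have hmem := h₁ hD
      rw [he] at hmem
      rcases Finset.mem_union.1 hmem with hmem | hmem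
      · exact (Finset.mem_sdiff.1 hmem).1
      · obtain ⟨c, hc, rfl⟩ := Finset.mem_image.1 hmem
        rw [Finset.union_comm] at hD
        exact absurd hD (hR.notMem h₁ S.2 gp hd hS hC.symm hN hc)

end Flips

/-! ### The configuration and the two triangulations -/

/-- The coordinates of the 17 points. -/
def coordinates : List (List ℕ) :=
  [[1472, 1385, 1852, 972, 831, 918],
   [1699, 796, 1041, 1776, 824, 922],
   [512, 1790, 0, 972, 820, 916],
   [1540, 171, 1041, 973, 826, 0],
   [884, 0, 1048, 967, 1646, 918],
   [0, 1200, 1042, 0, 828, 924],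
   [1642, 1106, 1040, 964, 825, 1719],
   [576, 82, 1034, 966, 23, 917],
   [1208, 24, 183, 966, 832, 917],
   [1643, 503, 1039, 154, 826, 910],
   [327, 1388, 1040, 964, 827, 116],
   [1220, 1580, 1047, 972, 0, 917],
   [893, 821, 1041, 969, 827, 917],
   [144, 534, 1042, 973, 830, 1720],
   [89, 844, 1041, 1773, 830, 911],
   [261, 205, 1924, 968, 822, 919],
   [900, 1660, 1036, 972, 1668, 915]]

/-- The rigid cells, as bit masks. -/
def rigidMasks : List ℕ := [
  4924, 5406, 5436, 6825, 6956, 7080, 7307, 7337, 7438, 7468, 7562, 7592, 13108, 13140, 15009,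
  15041, 15140, 15172, 15264, 15296, 20822, 21782, 22723, 22854, 22978, 23683, 23814, 23938,
  29012, 30913, 31044, 31168, 37545, 38027, 38057, 45729, 45761, 53443, 54403, 61633, 70204,
  70686, 70716, 78388, 78420, 86102, 87062, 94292, 102953, 102968, 103435, 103450, 103465,
  103480, 111137, 111152, 111169, 111184, 118851, 118866, 119811, 119826, 127041, 127056]

/-- The cells that complete the rigid cells to a triangulation, as bit masks. -/
def completingMasks : List ℕ := [
  2988, 3470, 3500, 5018, 5048, 5074, 5560, 6795, 6851, 6926, 6982, 7050, 7106, 7588, 7721, 7724,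
  9076, 9188, 10977, 10980, 11172, 11204, 12754, 13232, 13264, 14756, 14945, 14948, 17694, 17806,
  18886, 19595, 19598, 19846, 20890, 21786, 21812, 21898, 21912, 21924, 21936, 23716, 23940,
  24918, 25030, 26822, 27076, 28980, 29010, 29074, 29092, 29104, 29122, 30884, 31108, 35497,
  35553, 36009, 37403, 37459, 37515, 37530, 37560, 37571, 37586, 38072, 40097, 41697, 43233,
  45266, 45744, 45776, 47265, 50315, 51339, 51395, 52361, 53402, 54298, 54410, 54424, 54448,
  56353, 56449, 56480, 59585, 59586, 61522, 61586, 61616, 61634, 63521, 63617, 63648, 69918,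
  69974, 70171, 70227, 70414, 70426, 70428, 70470, 70482, 70484, 71209, 71212, 72203, 72206,
  72259, 72262, 72289, 72292, 72715, 72718, 73225, 73228, 73249, 73252, 74356, 78433, 78436,
  79969, 79972, 82974, 87092, 88131, 88134, 89091, 89094, 89121, 89124, 90198, 94260, 96289,
  96292, 96321, 96324, 98873, 98929, 102427, 102483, 102937, 102993, 107105, 107120, 115723,
  115738, 119841, 119856, 122962, 127009, 127024]

/-- The cells of a triangulation that has no rigid cell, as bit masks. -/
def flexibleMasks : List ℕ := [
  954, 1010, 2478, 2534, 2731, 2787, 2862, 2918, 2986, 2988, 3042, 3044, 8566, 8678, 8690, 9200,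
  10470, 16702, 16814, 16826, 17724, 17836, 17848, 18606, 19499, 19502, 19628, 24886, 24998,
  25010, 26726, 26790, 33339, 33395, 33451, 33466, 33507, 33522, 34987, 35043, 35497, 35553,
  41202, 41712, 43234, 49338, 50360, 51243, 51299, 51370, 52265, 52392, 57522, 59489, 59490,
  59554, 65854, 65910, 66107, 66163, 66350, 66362, 66364, 66406, 66418, 66420, 68139, 68142,
  68195, 68198, 68651, 68654, 69161, 69164, 73846, 81982, 82987, 82990, 83004, 84067, 84070,
  85027, 85030, 90166, 90214, 92257, 92260, 98363, 98419, 106610, 114731, 114746, 114787, 115753,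
  115768, 122930, 122977, 122978]

/-- The coordinates of the point with label `i`. -/
def row (i : ℕ) : List ℕ :=
  coordinates.getD i []

/-- The configuration of 17 points in `ℝ^6`. -/
noncomputable def config (i : Fin 17) : EuclideanSpace ℝ (Fin 6) :=
  WithLp.toLp 2 fun j => ((row i).getD j 0 : ℝ)

/-- The set of labels given by a bit mask. -/
def cell (m : ℕ) : Finset (Fin 17) :=
  Finset.univ.filter fun i => m.testBit i

/-- The family of cells given by a list of bit masks. -/
def cells (l : List ℕ) : Finset (Finset (Fin 17)) :=
  (l.map cell).toFinset

theorem mem_cell {m : ℕ} {i : Fin 17} : i ∈ cell m ↔ m.testBit i := by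
  simp [cell]

theorem mem_cells {l : List ℕ} {σ : Finset (Fin 17)} : σ ∈ cells l ↔ ∃ m ∈ l, cell m = σ := by
  simp [cells]

/-! ### General position, verified modulo a prime

The functions evaluated by the kernel are given by recursors and operations on `ℕ` that the kernel
can reduce quickly. -/

section Elimination

/-- The residues of `a * s - b * r` modulo `30011`. -/
noncomputable def cancel (a b : ℕ) (r s : List ℕ) : List ℕ :=
  List.rec (motive := fun _ => List ℕ → List ℕ) (fun _ => [])
    (fun x _ ih s => List.rec (motive := fun _ => List ℕ) []
      (fun y s _ => Nat.mod (Nat.add (Nat.mul a y)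
        (Nat.mul b (Nat.sub 30011 (Nat.mod x 30011)))) 30011 :: ih s) s) r s

/-- Eliminate the first entry of `s` by means of the row `a :: r`. -/
noncomputable def eliminate (a : ℕ) (r : List ℕ) (s : List ℕ) : List ℕ :=
  List.rec (motive := fun _ => List ℕ) [] (fun b s _ => cancel a b r s) s

/-- `List.map`, by the recursor. -/
noncomputable def mapRows (f : List ℕ → List ℕ) (l : List (List ℕ)) : List (List ℕ) :=
  List.rec (motive := fun _ => List (List ℕ)) [] (fun s _ ih => f s :: ih) l

/-- Check all sublists of `k + 1` rows of `l`, given a check `f` for lists of `k` rows. -/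
noncomputable def genericStep (k : ℕ) (f : ℕ → List (List ℕ) → Bool) (l : List (List ℕ)) :
    ℕ → Bool :=
  List.rec (motive := fun _ => ℕ → Bool) (fun _ => true)
    (fun s rs ih n => bif Nat.ble n k then true else
      List.rec (motive := fun _ => Bool) false (fun a r _ =>
        bif Nat.ble 1 (Nat.mod a 30011) then
          bif f (Nat.pred n) (mapRows (eliminate a r) rs) then ih (Nat.pred n) else false
        else false) s) l

/-- Check that any `k` of the rows `l` (at most `n` in number, of length `k`) are linearly
independent modulo `30011`. -/
noncomputable def generic (k : ℕ) : ℕ → List (List ℕ) → Bool :=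
  Nat.rec (fun _ _ => true) (fun k ih n l => genericStep k ih l n) k

instance : Fact (Nat.Prime 30011) := ⟨by norm_num⟩

/-- The pairing of a vector with a row. -/
def pair (n : ℕ → ZMod 30011) : List ℕ → ZMod 30011
  | [] => 0
  | a :: r => n 0 * a + pair (fun j => n (j + 1)) r

theorem pair_eq_sum (n : ℕ → ZMod 30011) (r : List ℕ) :
    pair n r = ∑ j ∈ Finset.range r.length, n j * (r.getD j 0 : ℕ) := by
  induction r generalizing n with
  | nil => simp [pair]
  | cons a r ih => rw [pair, ih, List.length_cons, Finset.sum_range_succ', add_comm]; simp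

theorem length_cancel (a b : ℕ) (r s : List ℕ) (h : r.length = s.length) :
    (cancel a b r s).length = s.length := by
  induction r generalizing s with
  | nil => exact h
  | cons x r ih =>
    cases s with
    | nil => rfl
    | cons y s => exact congrArg (· + 1) (ih s (by simpa using h))

/-- The term `30011 - x % 30011` represents `-x` without leaving the natural numbers. -/
theorem pair_cancel (a b : ℕ) (n : ℕ → ZMod 30011) (r s : List ℕ) (h : r.length = s.length) :
    pair n (cancel a b r s) = a * pair n s - b * pair n r := by
  induction r generalizing s n with
  | nil =>
    obtain rfl := List.length_eq_zero_iff.1 h.symm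
    simp [cancel, pair]
  | cons x r ih =>
    cases s with
    | nil => simp at h
    | cons y s =>
      change n 0 * (((a * y + b * (30011 - x % 30011)) % 30011 : ℕ) : ZMod 30011) +
        pair (fun j => n (j + 1)) (cancel a b r s) = _
      have hx : x % 30011 ≤ 30011 := (Nat.mod_lt x (by norm_num)).le
      rw [ih _ s (by simpa using h), ZMod.natCast_mod, pair, pair]
      push_cast [Nat.cast_sub hx]
      rw [ZMod.natCast_mod, show (30011 : ZMod 30011) = 0 from by exact_mod_cast ZMod.natCast_self 30011]
      ring

/-- A list of rows has trivial kernel modulo `30011`. -/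
def TrivialKernel (k : ℕ) (s : List (List ℕ)) : Prop :=
  ∀ n : ℕ → ZMod 30011, (∀ r ∈ s, pair n r = 0) → ∀ j < k, n j = 0

theorem mapRows_eq (f : List ℕ → List ℕ) (l : List (List ℕ)) : mapRows f l = l.map f := by
  induction l with
  | nil => rfl
  | cons s l ih => exact congrArg (f s :: ·) ih

/-- One step of Gaussian elimination: the tail of a kernel vector is in the kernel of the eliminated
rows, so it vanishes, and the pivot `a` then kills the first entry. -/
theorem trivialKernel_cons {k a : ℕ} {r : List ℕ} {s : List (List ℕ)}
    (ha : (a : ZMod 30011) ≠ 0) (hr : r.length = k) (hs : ∀ y ∈ s, y.length = k + 1)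
    (h : TrivialKernel k (s.map (eliminate a r))) : TrivialKernel (k + 1) ((a :: r) :: s) := by
  intro n hn
  have h0 : n 0 * a + pair (fun j => n (j + 1)) r = 0 := hn _ (List.mem_cons_self ..)
  have h1 : ∀ j < k, n (j + 1) = 0 := by
    refine h (fun j => n (j + 1)) fun y hy => ?_
    obtain ⟨y, hys, rfl⟩ := List.mem_map.1 hy
    have h2 := hn y (List.mem_cons_of_mem _ hys)
    have h3 := hs y hys
    cases y with
    | nil => simp at h3
    | cons b y =>
      change pair _ (cancel a b r y) = 0
      rw [pair] at h2
      rw [pair_cancel _ _ _ _ _ (by simp at h3; omega)]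
      linear_combination a * h2 - b * h0
  have h2 : pair (fun j => n (j + 1)) r = 0 := by
    rw [pair_eq_sum]
    exact Finset.sum_eq_zero fun j hj => by
      rw [h1 j (by rw [← hr]; exact Finset.mem_range.1 hj), zero_mul]
  rintro (_ | j) hj
  · rw [h2, add_zero] at h0
    exact (mul_eq_zero.1 h0).resolve_right ha
  · exact h1 j (by omega)

/-- A sublist either skips the first row or uses it as pivot row. One elimination therefore serves
all sublists beginning with that row. There is no column exchange, so the test is sufficient but not
necessary. -/
theorem trivialKernel_of_generic (k n : ℕ) (l : List (List ℕ)) (hn : l.length ≤ n)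
    (hl : ∀ r ∈ l, r.length = k) (h : generic k n l = true) :
    ∀ s, s.Sublist l → s.length = k → TrivialKernel k s := by
  induction k generalizing n l with
  | zero => exact fun s _ _ n _ j hj => absurd hj (Nat.not_lt_zero j)
  | succ k ihk =>
    change genericStep k (generic k) l n = true at h
    induction l generalizing n with
    | nil =>
      intro s hs hsl
      rw [List.sublist_nil.1 hs] at hsl
      simp at hsl
    | cons t l ihl =>
      intro s hs hsl
      change (bif Nat.ble n k then true else
        List.rec (motive := fun _ => Bool) false (fun a r _ =>
          bif Nat.ble 1 (Nat.mod a 30011) then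
            bif generic k (Nat.pred n) (mapRows (eliminate a r) l) then
              genericStep k (generic k) l (Nat.pred n) else false
          else false) t) = true at h
      have hnk : Nat.ble n k = false := by
        rw [Bool.eq_false_iff]
        intro hle
        have h1 := Nat.le_of_ble_eq_true hle
        have h2 := hs.length_le
        omega
      rw [hnk, cond_false] at h
      cases t with
      | nil => exact absurd h (by simp)
      | cons a r =>
        change (bif Nat.ble 1 (a % 30011) then
            bif generic k (Nat.pred n) (mapRows (eliminate a r) l) then
              genericStep k (generic k) l (Nat.pred n) else false
          else false) = true at h
        rw [Bool.cond_false_right, Bool.cond_false_right, Bool.and_eq_true, Bool.and_eq_true,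
          mapRows_eq] at h
        obtain ⟨ha, hg, hrest⟩ := h
        have hn' : l.length ≤ Nat.pred n := by simp at hn ⊢; omega
        have hl' : ∀ y ∈ l, y.length = k + 1 := fun y hy => hl y (List.mem_cons_of_mem _ hy)
        have hr : r.length = k := by simpa using hl _ (List.mem_cons_self ..)
        cases hs with
        | cons _ hs => exact ihl _ hn' hl' hrest s hs hsl
        | cons_cons _ hs =>
          rename_i s
          refine trivialKernel_cons ?_ hr (fun y hy => hl' y (hs.subset hy)) ?_
          · intro ha0
            rw [ZMod.natCast_eq_zero_iff] at ha0
            have h1 := Nat.le_of_ble_eq_true ha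
            rw [Nat.mod_eq_zero_of_dvd ha0] at h1
            omega
          · refine ihk _ _ (by simpa using hn') ?_ hg _ (hs.map _) (by simpa using hsl)
            intro y hy
            obtain ⟨y, hyl, rfl⟩ := List.mem_map.1 hy
            have h3 := hl' y hyl
            cases y with
            | nil => simp at h3
            | cons b y =>
              have h4 : y.length = k := by simpa using h3
              exact (length_cancel a b r y (hr.trans h4.symm)).trans h4

end Elimination

/-- The integer determinant of the homogeneous coordinates is nonzero modulo the prime, hence
nonzero, hence nonzero over the reals. An affine dependence is a left kernel vector of this matrix,
the column of ones accounting for the zero sum of its weights. -/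
theorem independent_of_trivialKernel {d : ℕ} {ι : Type*} {p : ι → EuclideanSpace ℝ (Fin d)}
    {σ : Finset ι} (hσ : σ.card = d + 1) (r : ι → List ℕ) (hr : ∀ i, (r i).length = d + 1)
    (hr0 : ∀ i, (r i).getD 0 0 = 1)
    (hrp : ∀ i (j : Fin d), p i j = ((r i).getD (j + 1) 0 : ℕ))
    (h : ∀ n : ℕ → ZMod 30011, (∀ i ∈ σ, pair n (r i) = 0) → ∀ j < d + 1, n j = 0) :
    Independent p σ := by
  let e : σ ≃ Fin (d + 1) := Finset.equivFinOfCardEq hσ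
  let M : Matrix (Fin (d + 1)) (Fin (d + 1)) ℤ :=
    Matrix.of fun a j => ((r (e.symm a)).getD j 0 : ℕ)
  have hM : ∀ {S : Type} [CommRing S] (i : σ) (j : Fin (d + 1)),
      M.map (Int.castRingHom S) (e i) j = ((r i).getD j 0 : ℕ) := by
    intro S _ i j
    change Int.castRingHom S ((r (e.symm (e i))).getD j 0 : ℕ) = _
    rw [e.symm_apply_apply]
    exact Int.cast_natCast _
  have hdet : M.det ≠ 0 := by
    intro h0
    have h1 : (M.map (Int.castRingHom (ZMod 30011))).det = 0 := by
      rw [← RingHom.mapMatrix_apply, ← RingHom.map_det, h0, map_zero]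
    obtain ⟨n, hn, hn0⟩ := Matrix.exists_mulVec_eq_zero_iff.2 h1
    refine hn (funext fun j => ?_)
    have h2 := h (fun i => if hi : i < d + 1 then n ⟨i, hi⟩ else 0) (fun i hi => ?_) j j.2
    · rwa [dif_pos j.2] at h2
    · rw [pair_eq_sum, hr, Finset.sum_range]
      have h3 := congrFun hn0 (e ⟨i, hi⟩)
      change ∑ j, M.map (Int.castRingHom (ZMod 30011)) (e ⟨i, hi⟩) j * n j = 0 at h3
      rw [← h3]
      refine Finset.sum_congr rfl fun j _ => ?_
      rw [hM, dif_pos j.2, mul_comm]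
  have hdetR : (M.map (Int.castRingHom ℝ)).det ≠ 0 := by
    rw [← RingHom.mapMatrix_apply, ← RingHom.map_det]
    simpa using hdet
  rw [Independent, affineIndependent_iff_of_fintype]
  intro w hw hwp
  rw [Finset.univ.weightedVSub_eq_linear_combination hw] at hwp
  have hv : Matrix.vecMul (fun a => w (e.symm a)) (M.map (Int.castRingHom ℝ)) = 0 := by
    funext j
    change ∑ a, w (e.symm a) * M.map (Int.castRingHom ℝ) a j = 0
    rw [← e.sum_comp]
    simp only [e.symm_apply_apply, hM]
    refine Fin.cases ?_ (fun j => ?_) j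
    · simp only [Fin.val_zero, hr0, Nat.cast_one, mul_one]
      exact hw
    · have h1 := congrArg (fun x : EuclideanSpace ℝ (Fin d) => x j) hwp
      simpa [hrp] using h1
  have := Matrix.eq_zero_of_vecMul_eq_zero hdetR hv
  intro i
  simpa using congrFun this (e i)

/-- The homogeneous coordinates of the points. -/
def homogeneousRows : List (List ℕ) :=
  coordinates.map fun r => 1 :: r

theorem generalPosition_config (h : generic 7 17 homogeneousRows = true) :
    GeneralPosition config := by
  intro σ hσ
  have hlen : ∀ i : Fin 17, (row i).length = 6 := by decide
  refine independent_of_trivialKernel hσ (fun i => 1 :: row i) (fun i => by simp [hlen])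
    (fun i => rfl) (fun i j => rfl) fun n hn => ?_
  have hrows : (List.finRange 17).map (fun i : Fin 17 => 1 :: row i) = homogeneousRows := by decide
  have hnodup : ((List.finRange 17).filter (· ∈ σ)).Nodup := (List.nodup_finRange 17).filter _
  have hfin : ((List.finRange 17).filter (· ∈ σ)).toFinset = σ := by
    ext i
    simp
  refine trivialKernel_of_generic 7 17 homogeneousRows (by decide) (by decide) h
    (((List.finRange 17).filter (· ∈ σ)).map fun i : Fin 17 => 1 :: row i) ?_ ?_ n ?_
  · rw [← hrows]
    exact List.filter_sublist.map _
  · rw [List.length_map, ← List.toFinset_card_of_nodup hnodup, hfin, hσ]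
  · intro r hr
    obtain ⟨i, hi, rfl⟩ := List.mem_map.1 hr
    exact hn i (by simpa using hi)

theorem config_injective (gp : GeneralPosition config) : Function.Injective config := by
  intro i j hij
  have h : Independent config {i, j} := gp.independent (by simp)
    (Finset.card_le_two.trans (by norm_num))
  have := AffineIndependent.injective h (a₁ := ⟨i, by simp⟩) (a₂ := ⟨j, by simp⟩) hij
  simpa using this

/-! ### Facets and the sides on which points lie

Signed integers are represented by natural numbers with an offset. The algorithm that finds the
normal vector of a facet needs no verification, since the result is tested. -/

section Facets

/-- The offset of the representation of integers. -/
@[irreducible] def offset : ℕ := 2 ^ 512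

/-- The dot product. -/
noncomputable def dot (l m : List ℕ) : ℕ :=
  List.rec (motive := fun _ => List ℕ → ℕ) (fun _ => 0)
    (fun a _ ih m => List.rec (motive := fun _ => ℕ) 0
      (fun b m _ => Nat.add (Nat.mul a b) (ih m)) m) l m

/-- The sum of the entries. -/
noncomputable def total (l : List ℕ) : ℕ :=
  List.rec 0 (fun a _ s => Nat.add a s) l

/-- `List.zipWith`, by the recursor. -/
noncomputable def zipRows (f : ℕ → ℕ → ℕ) (r s : List ℕ) : List ℕ :=
  List.rec (motive := fun _ => List ℕ → List ℕ) (fun _ => [])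
    (fun x _ ih s => List.rec (motive := fun _ => List ℕ) [] (fun y s _ => f x y :: ih s) s) r s

/-- Eliminate the first entry of `s` by means of the row `a :: r`, with offset entries. -/
noncomputable def eliminateOffset (a : ℕ) (r : List ℕ) (s : List ℕ) : List ℕ :=
  List.rec (motive := fun _ => List ℕ) [] (fun b s _ => zipRows
    (fun x y => Nat.sub
      (Nat.add offset (Nat.add (Nat.mul a y) (Nat.mul offset (Nat.add b x))))
      (Nat.add (Nat.mul b x) (Nat.mul offset (Nat.add a y)))) r s) s

/-- The product of two offset integers. -/
noncomputable def mulOffset (a n : ℕ) : ℕ :=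
  Nat.sub (Nat.add offset (Nat.add (Nat.mul a n) (Nat.mul offset offset)))
    (Nat.mul offset (Nat.add a n))

/-- The negative of the dot product of two vectors of offset integers. -/
noncomputable def negDotOffset (r n : List ℕ) : ℕ :=
  List.rec (motive := fun _ => List ℕ → ℕ) (fun _ => offset)
    (fun a _ ih n => List.rec (motive := fun _ => ℕ) 0 (fun b m _ =>
      Nat.sub (Nat.add (ih m) (Nat.mul offset (Nat.add a b)))
        (Nat.add (Nat.mul a b) (Nat.mul offset offset))) n) r n

/-- A vector orthogonal to `k` rows of length `k + 1`, by elimination. -/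
noncomputable def normalVector (k : ℕ) : List (List ℕ) → List ℕ :=
  Nat.rec (fun _ => [Nat.succ offset]) (fun _ ih l => List.rec (motive := fun _ => List ℕ) []
    (fun s rs _ => List.rec (motive := fun _ => List ℕ) []
      (fun a r _ => (fun n => negDotOffset r n ::
        List.rec [] (fun x _ l => mulOffset a x :: l) n)
          (ih (mapRows (eliminateOffset a r) rs))) s) l) k

/-- The entries of `l` selected by the bits of `m`. -/
noncomputable def select (l : List (List ℕ)) : ℕ → List (List ℕ) :=
  List.rec (motive := fun _ => ℕ → List (List ℕ)) (fun _ => [])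
    (fun a _ ih m => bif Nat.testBit m 0 then a :: ih (Nat.div m 2) else ih (Nat.div m 2)) l

/-- A normal vector of the hyperplane through the points `l`. -/
noncomputable def facetNormal (l : List (List ℕ)) : List ℕ :=
  List.rec [] (fun x₀ rs _ =>
    normalVector 5 (mapRows (zipRows (fun x y => Nat.sub (Nat.add offset y) x) x₀) rs)) l

/-- The positive part of the value at `x` of the separator with normal `N` through `x₀`. -/
noncomputable def lhs (N x₀ x : List ℕ) : ℕ :=
  Nat.add (dot N x) (Nat.mul offset (total x₀))

/-- The negative part of the value at `x` of the separator with normal `N` through `x₀`. -/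
noncomputable def rhs (N x₀ x : List ℕ) : ℕ :=
  Nat.add (dot N x₀) (Nat.mul offset (total x))

/-- The separator vanishes at `x`. -/
noncomputable def zero (N x₀ x : List ℕ) : Bool :=
  Nat.beq (lhs N x₀ x) (rhs N x₀ x)

/-- The separator is positive at `x`. -/
noncomputable def pos (N x₀ x : List ℕ) : Bool :=
  Nat.blt (rhs N x₀ x) (lhs N x₀ x)

/-- The separator is negative at `x`. -/
noncomputable def neg (N x₀ x : List ℕ) : Bool :=
  Nat.blt (lhs N x₀ x) (rhs N x₀ x)

/-- The points `x` and `y` lie strictly on the same side. -/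
noncomputable def agree (N x₀ x y : List ℕ) : Bool :=
  (pos N x₀ x && pos N x₀ y) || (neg N x₀ x && neg N x₀ y)

/-- The points `x` and `y` lie strictly on different sides. -/
noncomputable def differ (N x₀ x y : List ℕ) : Bool :=
  (pos N x₀ x && neg N x₀ y) || (neg N x₀ x && pos N x₀ y)

/-- Check the matching condition for the facet `τ` of `σ`, with the hyperplane `N`, `x₀`. -/
noncomputable def checkHyperplane (T : List ℕ) (σ v τ : ℕ) (N x₀ : List ℕ) : Bool :=
  (select coordinates τ).all (fun x => zero N x₀ x) &&
    match T.filter (fun c => Nat.beq (Nat.land c τ) τ && !Nat.beq c σ) with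
    | [] => (select coordinates (Nat.xor 131071 τ)).all fun x => agree N x₀ (row v) x
    | [b] => agree N x₀ (row v) (row v) &&
        (select coordinates (Nat.xor b τ)).all fun y => differ N x₀ (row v) y
    | _ => false

/-- Check the matching condition for the facet of `σ` opposite to `v`, if there is one. -/
noncomputable def checkFacet (T : List ℕ) (σ v : ℕ) : Bool :=
  !Nat.testBit σ v || checkHyperplane T σ v (Nat.xor σ (2 ^ v))
    (facetNormal (select coordinates (Nat.xor σ (2 ^ v))))
    ((select coordinates (Nat.xor σ (2 ^ v))).headD [])

/-- Check the matching condition for all facets of all cells. -/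
noncomputable def checkMatched (T : List ℕ) : Bool :=
  T.all fun σ => (List.range 17).all fun v => checkFacet T σ v

/-- Check that the facet `τ` separates the points `v` and `c`, and that a cell of `R` with this facet
contains neither of them. -/
noncomputable def checkSeparates (R : List ℕ) (c v τ : ℕ) (N x₀ : List ℕ) : Bool :=
  (R.any fun b => Nat.beq (Nat.land b τ) τ && (!Nat.testBit b v && !Nat.testBit b c)) &&
    (differ N x₀ (row v) (row c) && (select coordinates τ).all fun x => zero N x₀ x)

/-- Check that `R` is locked. -/
noncomputable def checkLocked (R : List ℕ) : Bool :=
  R.all fun σ => (List.range 17).all fun c => Nat.testBit σ c ||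
    (List.range 17).any fun v => Nat.testBit σ v &&
      checkSeparates R c v (Nat.xor σ (2 ^ v))
        (facetNormal (select coordinates (Nat.xor σ (2 ^ v))))
        ((select coordinates (Nat.xor σ (2 ^ v))).headD [])

/-! ### Soundness of the facet checks -/

theorem dot_eq_sum (N x : List ℕ) (k : ℕ) (h : x.length ≤ k) :
    dot N x = ∑ j ∈ Finset.range k, N.getD j 0 * x.getD j 0 := by
  induction N generalizing x k with
  | nil => simp [dot]
  | cons a N ih =>
    cases x with
    | nil => simp [dot]
    | cons b x =>
      obtain ⟨k, rfl⟩ : ∃ k', k = k' + 1 := ⟨k - 1, by simp at h; omega⟩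
      rw [Finset.sum_range_succ', add_comm]
      exact congrArg (a * b + ·) (ih x k (by simpa using h))

theorem total_eq_sum (x : List ℕ) (k : ℕ) (h : x.length ≤ k) :
    total x = ∑ j ∈ Finset.range k, x.getD j 0 := by
  induction x generalizing k with
  | nil => simp [total]
  | cons b x ih =>
    obtain ⟨k, rfl⟩ : ∃ k', k = k' + 1 := ⟨k - 1, by simp at h; omega⟩
    rw [Finset.sum_range_succ', add_comm]
    exact congrArg (b + ·) (ih k (by simpa using h))

/-- The affine function with normal `N` that vanishes at `x₀`. -/
noncomputable def separator (N x₀ : List ℕ) : EuclideanSpace ℝ (Fin 6) →ᵃ[ℝ] ℝ :=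
  (∑ j : Fin 6, ((N.getD j 0 : ℝ) - offset) •
    (EuclideanSpace.proj j : EuclideanSpace ℝ (Fin 6) →L[ℝ] ℝ).toLinearMap).toAffineMap +
    AffineMap.const ℝ _ ((offset : ℝ) * total x₀ - dot N x₀)

/-- The offset terms are distributed so that each side is a natural number; the sign of the
separator becomes a comparison in `ℕ`. -/
theorem separator_config (N x₀ : List ℕ) (i : Fin 17) :
    separator N x₀ (config i) = (lhs N x₀ (row i) : ℝ) - rhs N x₀ (row i) := by
  have hlen : ∀ i : Fin 17, (row i).length ≤ 6 := by decide
  have h1 : (lhs N x₀ (row i) : ℝ) =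
      (∑ j : Fin 6, (N.getD j 0 : ℝ) * (row i).getD j 0) + offset * total x₀ := by
    change ((dot N (row i) + offset * total x₀ : ℕ) : ℝ) = _
    rw [dot_eq_sum N (row i) 6 (hlen i), Finset.sum_range]
    push_cast
    rfl
  have h2 : (rhs N x₀ (row i) : ℝ) =
      dot N x₀ + offset * ∑ j : Fin 6, ((row i).getD j 0 : ℝ) := by
    change ((dot N x₀ + offset * total (row i) : ℕ) : ℝ) = _
    rw [total_eq_sum (row i) 6 (hlen i), Finset.sum_range]
    push_cast
    rfl
  have h3 : separator N x₀ (config i) =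
      (∑ j : Fin 6, ((N.getD j 0 : ℝ) - offset) * (row i).getD j 0) +
        (offset * total x₀ - dot N x₀) := by
    change (∑ j : Fin 6, ((N.getD j 0 : ℝ) - offset) •
      (EuclideanSpace.proj j : EuclideanSpace ℝ (Fin 6) →L[ℝ] ℝ).toLinearMap) (config i) +
        (offset * total x₀ - dot N x₀) = _
    rw [LinearMap.sum_apply]
    rfl
  rw [h1, h2, h3]
  simp only [sub_mul, Finset.sum_sub_distrib, Finset.mul_sum]
  ring

theorem separator_eq_zero {N x₀ : List ℕ} {i : Fin 17} (h : zero N x₀ (row i) = true) :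
    separator N x₀ (config i) = 0 := by
  rw [separator_config, Nat.eq_of_beq_eq_true h, sub_self]

theorem separator_pos {N x₀ : List ℕ} {i : Fin 17} (h : pos N x₀ (row i) = true) :
    0 < separator N x₀ (config i) := by
  rw [separator_config, sub_pos, Nat.cast_lt]
  exact Nat.le_of_ble_eq_true h

theorem separator_neg {N x₀ : List ℕ} {i : Fin 17} (h : neg N x₀ (row i) = true) :
    separator N x₀ (config i) < 0 := by
  rw [separator_config, sub_neg, Nat.cast_lt]
  exact Nat.le_of_ble_eq_true h

theorem mul_pos_of_agree {N x₀ : List ℕ} {i j : Fin 17}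
    (h : agree N x₀ (row i) (row j) = true) :
    0 < separator N x₀ (config i) * separator N x₀ (config j) := by
  rw [agree, Bool.or_eq_true, Bool.and_eq_true, Bool.and_eq_true] at h
  rcases h with ⟨h, h'⟩ | ⟨h, h'⟩
  · exact mul_pos (separator_pos h) (separator_pos h')
  · exact mul_pos_of_neg_of_neg (separator_neg h) (separator_neg h')

theorem mul_neg_of_differ {N x₀ : List ℕ} {i j : Fin 17}
    (h : differ N x₀ (row i) (row j) = true) :
    separator N x₀ (config i) * separator N x₀ (config j) < 0 := by
  rw [differ, Bool.or_eq_true, Bool.and_eq_true, Bool.and_eq_true] at h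
  rcases h with ⟨h, h'⟩ | ⟨h, h'⟩
  · exact mul_neg_of_pos_of_neg (separator_pos h) (separator_neg h')
  · exact mul_neg_of_neg_of_pos (separator_neg h) (separator_pos h')

theorem mem_select (l : List (List ℕ)) (m i : ℕ) (hi : i < l.length) (hm : m.testBit i = true) :
    l.getD i [] ∈ select l m := by
  induction l generalizing m i with
  | nil => simp at hi
  | cons a l ih =>
    change _ ∈ (bif Nat.testBit m 0 then a :: select l (m / 2) else select l (m / 2))
    cases i with
    | zero => rw [hm]; exact List.mem_cons_self ..
    | succ i =>
      rw [Nat.testBit_succ] at hm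
      have := ih (m / 2) i (by simpa using hi) hm
      cases Nat.testBit m 0
      · exact this
      · exact List.mem_cons_of_mem _ this

theorem forall_of_all_select {f : List ℕ → Bool} {m : ℕ}
    (h : (select coordinates m).all f = true) (i : Fin 17) (hi : m.testBit i = true) :
    f (row i) = true :=
  List.all_eq_true.1 h _ (mem_select _ m i i.2 hi)

theorem cell_xor_two_pow {σ : ℕ} {v : Fin 17} (hv : v ∈ cell σ) :
    cell (σ ^^^ 2 ^ (v : ℕ)) = (cell σ).erase v := by
  ext i
  rw [mem_cell] at hv
  rw [mem_cell, Finset.mem_erase, mem_cell, Nat.testBit_xor, Nat.testBit_two_pow]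
  by_cases h : i = v
  · subst h
    simp [hv]
  · have : ¬ (v : ℕ) = i := fun h' => h (Fin.ext h'.symm)
    simp [h, this]

/-- The bound `131072 = 2 ^ 17` ensures that `τ` has no bits invisible to `cell`. -/
theorem land_eq_iff {c τ : ℕ} (hτ : τ < 131072) : c &&& τ = τ ↔ cell τ ⊆ cell c := by
  constructor
  · intro h i hi
    rw [mem_cell] at hi ⊢
    rw [← h, Nat.testBit_and, Bool.and_eq_true] at hi
    exact hi.1
  · intro h
    refine Nat.eq_of_testBit_eq fun i => ?_
    rw [Nat.testBit_and]
    by_cases hi : i < 17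
    · have h1 := @h ⟨i, hi⟩
      rw [mem_cell, mem_cell] at h1
      cases hτi : τ.testBit i
      · simp
      · simpa using h1 hτi
    · have : τ.testBit i = false := by
        refine Nat.testBit_lt_two_pow (hτ.trans_le ?_)
        exact (Nat.pow_le_pow_right (n := 2) (by norm_num) (not_lt.1 hi) : 2 ^ 17 ≤ 2 ^ i)
      rw [this, Bool.and_false]

theorem exists_of_checkHyperplane {T : List ℕ} {σ : ℕ} {v : Fin 17} {τ : ℕ} {N x₀ : List ℕ}
    (hτ : τ < 131072) (hv : v ∉ cell τ) (h : checkHyperplane T σ v τ N x₀ = true) :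
    ∃ g : EuclideanSpace ℝ (Fin 6) →ᵃ[ℝ] ℝ, (∀ i ∈ cell τ, g (config i) = 0) ∧ 0 < g (config v) ∧
      (((∀ i, i ∉ cell τ → 0 < g (config i)) ∧ ∀ ρ ∈ cells T, cell τ ⊆ ρ → ρ = cell σ) ∨
        ∃ σ' ∈ cells T, cell τ ⊆ σ' ∧ (∀ j ∈ σ', j ∉ cell τ → g (config j) < 0) ∧
          ∀ ρ ∈ cells T, cell τ ⊆ ρ → ρ = cell σ ∨ ρ = σ') := by
  rw [checkHyperplane, Bool.and_eq_true] at h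
  obtain ⟨hz, h⟩ := h
  set g := separator N x₀ with hg
  have hsmul : ∀ i, (g (config v) • g) (config i) = g (config v) * g (config i) := fun _ => rfl
  have hgz : ∀ i ∈ cell τ, (g (config v) • g) (config i) = 0 := fun i hi => by
    rw [hsmul,
      separator_eq_zero (forall_of_all_select hz i (mem_cell.1 hi)), mul_zero]
  have hfilter : ∀ ρ ∈ cells T, cell τ ⊆ ρ → ρ = cell σ ∨
      ∃ c ∈ T.filter (fun c => Nat.beq (Nat.land c τ) τ && !Nat.beq c σ), cell c = ρ := by
    intro ρ hρ hs
    obtain ⟨c, hc, rfl⟩ := mem_cells.1 hρ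
    by_cases hcσ : c = σ
    · exact Or.inl (by rw [hcσ])
    · refine Or.inr ⟨c, List.mem_filter.2 ⟨hc, ?_⟩, rfl⟩
      rw [Bool.and_eq_true, Nat.beq_eq, Bool.not_eq_true']
      exact ⟨(land_eq_iff hτ).2 hs,
        Bool.eq_false_iff.2 fun h => hcσ (Nat.eq_of_beq_eq_true h)⟩
  have hmem : ∀ c ∈ T.filter (fun c => Nat.beq (Nat.land c τ) τ && !Nat.beq c σ),
      c ∈ T ∧ cell τ ⊆ cell c := by
    intro c hc
    obtain ⟨hcT, hc⟩ := List.mem_filter.1 hc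
    rw [Bool.and_eq_true] at hc
    exact ⟨hcT, (land_eq_iff hτ).1 (Nat.eq_of_beq_eq_true hc.1)⟩
  -- The computed normal has no prescribed orientation; scaling by the value at `v` makes the
  -- function positive there.
  refine ⟨g (config v) • g, hgz, ?_⟩
  simp only [hsmul]
  generalize T.filter (fun c => Nat.beq (Nat.land c τ) τ && !Nat.beq c σ) = l at h hfilter hmem
  match l, h, hfilter, hmem with
  | [], h, hfilter, _ =>
    have hout : ∀ i, i ∉ cell τ → 0 < g (config v) * g (config i) := fun i hi => by
      refine mul_pos_of_agree (forall_of_all_select h i ?_)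
      rw [mem_cell] at hi
      -- `131071 = 2 ^ 17 - 1`, so this mask is the complement of the facet.
      change (131071 ^^^ τ).testBit i = true
      rw [Nat.testBit_xor, Bool.eq_false_iff.2 hi, Bool.xor_false]
      clear hi
      revert i
      decide
    exact ⟨hout v hv, Or.inl ⟨hout, fun ρ hρ hs => by simpa using hfilter ρ hρ hs⟩⟩
  | [b], h, hfilter, hmem =>
    rw [Bool.and_eq_true] at h
    obtain ⟨hbT, hb⟩ := hmem b (List.mem_singleton_self b)
    -- That `v` agrees with itself just says that it is off the hyperplane.
    refine ⟨mul_pos_of_agree h.1, Or.inr ⟨cell b, mem_cells.2 ⟨b, hbT, rfl⟩, hb, fun j hj hjτ => ?_,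
      fun ρ hρ hs => ?_⟩⟩
    · refine mul_neg_of_differ (forall_of_all_select h.2 j ?_)
      rw [mem_cell] at hj hjτ
      change (b ^^^ τ).testBit j = true
      rw [Nat.testBit_xor, Bool.eq_false_iff.2 hjτ, Bool.xor_false, hj]
    · refine (hfilter ρ hρ hs).imp_right ?_
      rintro ⟨c, hc, rfl⟩
      rw [List.mem_singleton.1 hc]

theorem xor_two_pow_lt {σ : ℕ} (hσ : σ < 131072) (v : Fin 17) : σ ^^^ 2 ^ (v : ℕ) < 131072 :=
  Nat.xor_lt_two_pow (n := 17) hσ (Nat.pow_lt_pow_right (by norm_num) v.2)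

theorem isMatched_of_checkMatched {T : List ℕ} (hT : ∀ σ ∈ T, σ < 131072)
    (h : checkMatched T = true) : IsMatched config (cells T) := by
  intro σ hσ v hv
  obtain ⟨σ, hσT, rfl⟩ := mem_cells.1 hσ
  have h1 := List.all_eq_true.1 (List.all_eq_true.1 h σ hσT) v (List.mem_range.2 v.2)
  rw [checkFacet, show Nat.testBit σ v = true from mem_cell.1 hv, Bool.not_true,
    Bool.false_or] at h1
  have h2 := exists_of_checkHyperplane (xor_two_pow_lt (hT σ hσT) v)
    (by rw [cell_xor_two_pow hv]; exact Finset.notMem_erase v _) h1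
  rwa [cell_xor_two_pow hv] at h2

/-- If the facet is in no other cell, its matched neighbour could only be `σ` itself, with `v` on
both sides of the hyperplane; so the boundary alternative holds. -/
theorem IsMatched.hasBoundaryFacet {d : ℕ} {ι : Type*} [DecidableEq ι]
    {p : ι → EuclideanSpace ℝ (Fin d)} {T : Finset (Finset ι)} (hm : IsMatched p T)
    {σ : Finset ι} (hσ : σ ∈ T) {v : ι} (hv : v ∈ σ)
    (h : ∀ ρ ∈ T, σ.erase v ⊆ ρ → ρ = σ) : HasBoundaryFacet p T := by
  obtain ⟨g, hg0, hgv, ⟨hb, -⟩ | ⟨σ', hσ', hs, hneg, -⟩⟩ := hm σ hσ v hv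
  · exact ⟨σ, hσ, v, hv, g, hg0, hb, h⟩
  · rw [h σ' hσ' hs] at hneg
    exact absurd hgv (hneg v hv (Finset.notMem_erase v σ)).not_gt

theorem isLocked_of_checkLocked {R : List ℕ} (hR : ∀ σ ∈ R, σ < 131072)
    (hfull : ∀ σ ∈ cells R, IsFullCell config σ) (h : checkLocked R = true) :
    IsLocked config (cells R) := by
  intro σ hσ c hc
  have hσf := hfull σ hσ
  obtain ⟨σ, hσR, rfl⟩ := mem_cells.1 hσ
  have h1 := List.all_eq_true.1 (List.all_eq_true.1 h σ hσR) c (List.mem_range.2 c.2)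
  rw [show Nat.testBit σ c = false from Bool.eq_false_iff.2 fun h => hc (mem_cell.2 h),
    Bool.false_or, List.any_eq_true] at h1
  obtain ⟨v, hv17, h1⟩ := h1
  rw [List.mem_range] at hv17
  obtain ⟨v, rfl⟩ : ∃ w : Fin 17, v = w := ⟨⟨v, hv17⟩, rfl⟩
  rw [Bool.and_eq_true] at h1
  obtain ⟨hvσ, h1⟩ := h1
  have hv : v ∈ cell σ := mem_cell.2 hvσ
  rw [checkSeparates, Bool.and_eq_true, Bool.and_eq_true, List.any_eq_true] at h1
  obtain ⟨⟨b, hbR, hb⟩, hd, hz⟩ := h1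
  rw [Bool.and_eq_true, Bool.and_eq_true] at hb
  obtain ⟨hb1, hb2, hb3⟩ := hb
  refine ⟨v, hv, ?_, cell b, mem_cells.2 ⟨b, hbR, rfl⟩, ?_, ?_, ?_⟩
  -- The separator is its value at `v` times the barycentric coordinate of `v`, so the product of
  -- its values at `v` and `c` is a square times that coordinate at `c`.
  · have h2 := mul_neg_of_differ hd
    rw [affine_eq_bary_mul hσf hv (fun i hi => separator_eq_zero (forall_of_all_select hz i
      (mem_cell.1 (by rw [← cell_xor_two_pow hv] at hi; exact hi)))) (config c)] at h2
    by_contra h3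
    nlinarith [mul_nonneg (not_lt.1 h3) (mul_self_nonneg (separator
      (facetNormal (select coordinates (Nat.xor σ (2 ^ (v : ℕ)))))
        ((select coordinates (Nat.xor σ (2 ^ (v : ℕ)))).headD []) (config v)))]
  · intro he
    rw [← he, mem_cell] at hv
    rw [hv] at hb2
    exact absurd hb2 (by decide)
  · rw [← cell_xor_two_pow hv]
    exact (land_eq_iff (xor_two_pow_lt (hR σ hσR) v)).1 (Nat.eq_of_beq_eq_true hb1)
  · intro hcb
    rw [mem_cell.1 hcb] at hb3
    exact absurd hb3 (by decide)

end Facets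

/-! ### Evaluation of the finite checks -/

section Verification

set_option maxRecDepth 100000

theorem generic_homogeneousRows : generic 7 17 homogeneousRows = true := by
  decide +kernel

theorem checkMatched_rigid : checkMatched (rigidMasks ++ completingMasks) = true := by
  decide +kernel

theorem checkMatched_flexible : checkMatched flexibleMasks = true := by
  decide +kernel

theorem checkLocked_rigid : checkLocked rigidMasks = true := by
  decide +kernel

end Verification

/-! ### From the checks to the two triangulations -/

theorem isFullCell_cells (gp : GeneralPosition config) {l : List ℕ}
    (hl : ∀ m ∈ l, (cell m).card = 7) : ∀ σ ∈ cells l, IsFullCell config σ := by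
  intro σ hσ
  obtain ⟨m, hm, rfl⟩ := mem_cells.1 hσ
  exact ⟨gp _ (hl m hm), hl m hm⟩

theorem isTriangulation_cells (gp : GeneralPosition config) {l : List ℕ}
    (hl : ∀ m ∈ l, (cell m).card = 7) (hlt : ∀ m ∈ l, m < 131072) (h : checkMatched l = true)
    {m : ℕ} {v : Fin 17} (hm : m ∈ l) (hv : v ∈ cell m)
    (hb : ∀ c ∈ l, (cell m).erase v ⊆ cell c → cell c = cell m) :
    IsTriangulation config (cells l) := by
  have hmatched := isMatched_of_checkMatched hlt h
  refine hmatched.isTriangulation gp (isFullCell_cells gp hl) (by norm_num)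
    (hmatched.hasBoundaryFacet (mem_cells.2 ⟨m, hm, rfl⟩) hv fun ρ hρ => ?_)
  obtain ⟨c, hc, rfl⟩ := mem_cells.1 hρ
  exact hb c hc

end PointConfiguration

open PointConfiguration

/-- There are 17 distinct points in general position in `ℝ^6` whose graph of triangulations is not
connected, in the strong sense that some two triangulations are not joined by a sequence of flips
(and not because there would be no triangulation at all). -/
theorem mainTheorem1 :
    ∃ p : Fin 17 → EuclideanSpace ℝ (Fin 6),
      Function.Injective p ∧
      PointConfiguration.GeneralPosition p ∧
      ¬ (PointConfiguration.flipGraph p).Preconnected := by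
  have gp := generalPosition_config generic_homogeneousRows
  have hT : ∀ m ∈ rigidMasks ++ completingMasks, (cell m).card = 7 := by decide +kernel
  have hT' : ∀ m ∈ flexibleMasks, (cell m).card = 7 := by decide +kernel
  -- The facet of cell 4924 opposite to point 12 is in no other cell of the list, which supplies the
  -- boundary facet; likewise for cell 954 and point 1 in the second list.
  have htri := isTriangulation_cells gp hT (by decide +kernel) checkMatched_rigid
    (m := 4924) (v := 12) (by decide +kernel) (by decide +kernel) (by decide +kernel)
  have htri' := isTriangulation_cells gp hT' (by decide +kernel) checkMatched_flexible
    (m := 954) (v := 1) (by decide +kernel) (by decide +kernel) (by decide +kernel)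
  have hlocked : IsLocked config (cells rigidMasks) :=
    isLocked_of_checkLocked (by decide +kernel)
      (isFullCell_cells gp fun m hm => hT m (List.mem_append_left _ hm)) checkLocked_rigid
  refine ⟨config, config_injective gp, gp, fun hconn => ?_⟩
  have hsub := hlocked.subset_of_reachable gp (by simp) (by norm_num)
    (hconn ⟨_, htri⟩ ⟨_, htri'⟩) fun σ hσ => ?_
  -- Any path of flips would carry the rigid cell 4924 into the second triangulation, which does not
  -- have it.
  · obtain ⟨c, hc, he⟩ := mem_cells.1 (hsub (mem_cells.2 ⟨4924, by decide +kernel, rfl⟩))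
    have hne : ∀ c ∈ flexibleMasks, cell c ≠ cell 4924 := by decide +kernel
    exact hne c hc he
  · obtain ⟨m, hm, he⟩ := mem_cells.1 hσ
    exact mem_cells.2 ⟨m, List.mem_append_left _ hm, he⟩
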